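/- **Setting.** Let $G=(V,E)$ be a finite simple graph with totally ordered vertex set (edges are written $\langle i,j\rangle$ with $i<j$; subgraphs inherit the order, which plays no role when $u$ is symmetric), and let $v:\{0,1\}\to\mathbb R$, $u:\{0,1\}^2\to\mathbb R$. Put $C_G(x)=\sum_{i\in V}v(x_i)+\sum_{\langle i,j\rangle\in E}u(x_i,x_j)$ for $x\in\{0,1\}^V$. On $(\mathbb C^2)^{\otimes V}$ let $H_0=-\sum_{i\in V}X_i$ ($X_i$ the bit flip on qubit $i$), let $H_1$ be given by $H_1|x\rangle=-C_G(x)|x\rangle$, and for a runtime $T>0$ let $H(t)=(1-\tfrac tT)H_0+\tfrac tT H_1$. Let $U^G_{0,t}$ be the solution of $i\,\partial_tU^G_{0,t}=H(t)U^G_{0,t}$, $U^G_{0,0}=I$, and $|\psi^G(T)\rangle=U^G_{0,T}|\psi_0\rangle$, where $|\psi_0\rangle$ is the uniform superposition of all bit strings. For a subgraph $X$ of $G$, an observable on $X$ is a Hermitian operator $O_X$ on the qubits of $X$; on the qubits of a larger vertex set it acts as $O_X\otimes I$. Let $B_r$ be the neighbourhood of $X$ at distance $r$: the subgraph of $G$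 consisting of $X$ and of all vertices and edges that lie on a path of $G$ of length at most $r$ with an end-point in $X$. Annealing on $B_r$ means the same procedure applied to the graph $B_r$ on its own qubits, and for $\Lambda\in\{G,B_r\}$ we write $E_\Lambda(T)=\langle\psi^\Lambda(T)|O_X|\psi^\Lambda(T)\rangle$. Norms are operator norms. **Corollary.** Fix $v$, $u$, a degree bound $d$ and a size bound $m$. 1. For every $\varepsilon>0$, $T>0$ and $K$ there is a radius $r(\varepsilon,T)$, depending otherwise only on $v,u,d,m,K$, such that for every $r\ge r(\varepsilon,T)$ (in particular for $r=r(\varepsilon,T)$), every finite graph $G$ of maximum degree at most $d$, every subgraph $X$ of $G$ with at most $m$ vertices and every observable $O_X$ on $X$ with $\|O_X\|\le K$, $$|E_G(T)-E_{B_r}(T)|\le\varepsilon .$$ 2. There are constants $v_{LR},\mu,C>0$, depending only on $v,u,d,m$, such that for every such $G$ and $X$, every observable $O_X$ on $X$, every $T>0$ and every integer $r\ge v_{LR}T$, $$\bigl\|(U^G_{0,T})^\dagger O_XU^G_{0,T}-(U^{B_r}_{0,T})^\dagger O_XU^{B_r}_{0,T}\bigr\|\le C\,\|O_X\|\,e^{-\mu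 r},$$ where the second operator acts as the identity on the qubits outside $B_r$. -/

import Mathlib

open scoped Matrix.Norms.L2Operator

namespace QuantumAnnealing

/-! ### Linear differential equations with an affine generator

Existence of a global solution of `U' = (a + t b) U`, `U 0 = 1`, needed so that the annealing
evolution below is a well-defined object. -/

section AffineODE

variable {A : Type*} [NormedRing A] [NormedAlgebra ℝ A]

/-- Taylor coefficients of the solution of `U' = (a + t b) U`, `U 0 = 1`. -/
noncomputable def affineCoeff (a b : A) : ℕ → A
  | 0 => 1
  | 1 => a
  | n + 2 => ((n : ℝ) + 2)⁻¹ • (a * affineCoeff a b (n + 1) + b * affineCoeff a b n)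

theorem affineCoeff_bound (a b : A) {ρ : ℝ} (hρ : 0 < ρ) :
    ∃ C : ℝ, ∀ n, ‖affineCoeff a b n‖ ≤ C * ρ ^ n := by
  obtain ⟨N, hN⟩ := exists_nat_ge (‖a‖ / ρ + ‖b‖ / ρ ^ 2)
  set C : ℝ := ∑ k ∈ Finset.range (N + 2), ‖affineCoeff a b k‖ / ρ ^ k with hC
  have hC0 : 0 ≤ C := Finset.sum_nonneg fun k _ => by positivity
  refine ⟨C, fun n => ?_⟩
  induction n using Nat.strong_induction_on with
  | _ n ih =>
    by_cases hn : n < N + 2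
    · have h1 : ‖affineCoeff a b n‖ / ρ ^ n ≤ C :=
        Finset.single_le_sum (f := fun k => ‖affineCoeff a b k‖ / ρ ^ k)
          (fun k _ => by positivity) (Finset.mem_range.2 hn)
      rwa [div_le_iff₀ (by positivity)] at h1
    · obtain ⟨m, rfl⟩ : ∃ m, n = m + 2 := ⟨n - 2, by omega⟩
      have i1 := ih (m + 1) (by omega)
      have i0 := ih m (by omega)
      have hNm : (N : ℝ) ≤ m := by exact_mod_cast (by omega : N ≤ m)
      have h1 : ‖a * affineCoeff a b (m + 1) + b * affineCoeff a b m‖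
          ≤ ‖a‖ * (C * ρ ^ (m + 1)) + ‖b‖ * (C * ρ ^ m) :=
        (norm_add_le _ _).trans (add_le_add
          ((norm_mul_le _ _).trans (by gcongr)) ((norm_mul_le _ _).trans (by gcongr)))
      have h2 : ‖a‖ * (C * ρ ^ (m + 1)) + ‖b‖ * (C * ρ ^ m)
          = (‖a‖ / ρ + ‖b‖ / ρ ^ 2) * (C * ρ ^ (m + 2)) := by
        field_simp
        ring
      have h3 : (‖a‖ / ρ + ‖b‖ / ρ ^ 2) * (C * ρ ^ (m + 2))
          ≤ ((m : ℝ) + 2) * (C * ρ ^ (m + 2)) := by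
        apply mul_le_mul_of_nonneg_right _ (by positivity)
        linarith
      rw [affineCoeff, norm_smul, Real.norm_of_nonneg (by positivity),
        inv_mul_le_iff₀ (by positivity)]
      exact h1.trans (h2.le.trans h3)

theorem affineCoeff_summable [CompleteSpace A] (a b : A) (t : ℝ) :
    Summable fun n => t ^ n • affineCoeff a b n := by
  obtain ⟨C, hC⟩ := affineCoeff_bound a b (ρ := (2 * (|t| + 1))⁻¹) (by positivity)
  refine Summable.of_norm_bounded (g := fun n => C * (1 / 2 : ℝ) ^ n)
    (summable_geometric_two.mul_left C) fun n => ?_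
  rw [norm_smul, norm_pow, Real.norm_eq_abs]
  calc |t| ^ n * ‖affineCoeff a b n‖
      ≤ (|t| + 1) ^ n * (C * (2 * (|t| + 1))⁻¹ ^ n) := by
        gcongr
        · linarith
        · exact hC n
    _ = C * (1 / 2 : ℝ) ^ n := by
        have : (|t| + 1) ≠ 0 := by positivity
        rw [mul_left_comm, ← mul_pow]
        congr 2
        field_simp

theorem affineCoeff_deriv_bound (a b : A) {R : ℝ} (hR : 0 < R) :
    ∃ C : ℝ, ∀ (n : ℕ) (y : ℝ), |y| ≤ R →
      ‖((n : ℝ) * y ^ (n - 1)) • affineCoeff a b n‖ ≤ C * ((n : ℝ) ^ 1 * (1 / 2 : ℝ) ^ n) := by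
  obtain ⟨C, hC⟩ := affineCoeff_bound a b (ρ := (2 * R)⁻¹) (by positivity)
  refine ⟨C / R, fun n y hy => ?_⟩
  rcases n with _ | n
  · simp
  · rw [norm_smul, norm_mul, norm_pow, Real.norm_eq_abs, Real.norm_eq_abs, Nat.abs_cast,
      Nat.add_sub_cancel]
    calc ((n + 1 : ℕ) : ℝ) * |y| ^ n * ‖affineCoeff a b (n + 1)‖
        ≤ ((n + 1 : ℕ) : ℝ) * R ^ n * (C * (2 * R)⁻¹ ^ (n + 1)) := by
          gcongr
          exact hC _
      _ = (C / R) * (((n + 1 : ℕ) : ℝ) ^ 1 * (1 / 2 : ℝ) ^ (n + 1)) := by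
          rw [inv_pow, mul_pow, one_div, inv_pow, pow_succ R n]
          field_simp

theorem exists_affine_solution [CompleteSpace A] (a b : A) :
    ∃ U : ℝ → A, U 0 = 1 ∧ ∀ t, HasDerivAt U ((a + t • b) * U t) t := by
  refine ⟨fun t => ∑' n : ℕ, t ^ n • affineCoeff a b n, ?_, fun t => ?_⟩
  · show ∑' n : ℕ, (0 : ℝ) ^ n • affineCoeff a b n = 1
    rw [tsum_eq_single 0 (by intro n hn; simp [hn])]
    simp [affineCoeff]
  · have hR0 : 0 < |t| + 1 := by positivity
    obtain ⟨C, hC⟩ := affineCoeff_deriv_bound a b hR0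
    have hu : Summable fun n : ℕ => C * ((n : ℝ) ^ 1 * (1 / 2 : ℝ) ^ n) :=
      (summable_pow_mul_geometric_of_norm_lt_one (R := ℝ) 1 (r := 1 / 2) (by
        rw [Real.norm_eq_abs]; norm_num)).mul_left C
    have key : HasDerivAt (fun t : ℝ => ∑' n : ℕ, t ^ n • affineCoeff a b n)
        (∑' n : ℕ, ((n : ℝ) * t ^ (n - 1)) • affineCoeff a b n) t := by
      have hg : ∀ (n : ℕ) (y : ℝ), y ∈ Metric.ball (0 : ℝ) (|t| + 1) →
          HasDerivAt (fun t : ℝ => t ^ n • affineCoeff a b n)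
            (((n : ℝ) * y ^ (n - 1)) • affineCoeff a b n) y :=
        fun n y _ => (hasDerivAt_pow n y).smul_const _
      have hg' : ∀ (n : ℕ) (y : ℝ), y ∈ Metric.ball (0 : ℝ) (|t| + 1) →
          ‖((n : ℝ) * y ^ (n - 1)) • affineCoeff a b n‖ ≤ C * ((n : ℝ) ^ 1 * (1 / 2 : ℝ) ^ n) :=
        fun n y hy => hC n y (mem_ball_zero_iff.1 hy).le
      have ht : t ∈ Metric.ball (0 : ℝ) (|t| + 1) := by
        rw [mem_ball_zero_iff, Real.norm_eq_abs]
        linarith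
      exact hasDerivAt_tsum_of_isPreconnected hu Metric.isOpen_ball
        (convex_ball (0 : ℝ) (|t| + 1)).isPreconnected hg hg' ht (affineCoeff_summable a b t) ht
    have hs := affineCoeff_summable a b t
    have hd : Summable fun n : ℕ => ((n : ℝ) * t ^ (n - 1)) • affineCoeff a b n :=
      Summable.of_norm_bounded hu fun n => hC n t (by linarith)
    have hd1 := (summable_nat_add_iff 1).2 hd
    have ha := hs.mul_left a
    have hb := (hs.mul_left b).const_smul t
    have ha1 := (summable_nat_add_iff 1).2 ha
    have e : (a + t • b) * ∑' n : ℕ, t ^ n • affineCoeff a b n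
        = ∑' n : ℕ, ((n : ℝ) * t ^ (n - 1)) • affineCoeff a b n := by
      rw [hd.tsum_eq_zero_add, hd1.tsum_eq_zero_add, add_mul, smul_mul_assoc,
        ← hs.tsum_mul_left a, ← hs.tsum_mul_left b, ← (hs.mul_left b).tsum_const_smul t,
        ha.tsum_eq_zero_add, add_assoc, ← ha1.tsum_add hb]
      have e0 : a * t ^ 0 • affineCoeff a b 0 = ((0 + 1 : ℕ) : ℝ) • t ^ (0 + 1 - 1) •
          affineCoeff a b (0 + 1) := by
        simp [affineCoeff]
      have e1 : ∀ n : ℕ, a * t ^ (n + 1) • affineCoeff a b (n + 1)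
          + t • (b * t ^ n • affineCoeff a b n)
          = (((n + 1 + 1 : ℕ) : ℝ) * t ^ (n + 1 + 1 - 1)) • affineCoeff a b (n + 1 + 1) := by
        intro n
        have hn : ((n : ℝ) + 2) ≠ 0 := by positivity
        have hc : ((n + 1 + 1 : ℕ) : ℝ) * t ^ (n + 1 + 1 - 1) * ((n : ℝ) + 2)⁻¹ = t ^ (n + 1) := by
          rw [Nat.add_sub_cancel]
          push_cast
          field_simp
          ring
        rw [affineCoeff, smul_smul, hc, smul_add, mul_smul_comm, mul_smul_comm, smul_smul,
          ← pow_succ']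
      rw [tsum_congr e1, e0, smul_smul]
      simp
    have e' : (a + t • b) * (fun t : ℝ => ∑' n : ℕ, t ^ n • affineCoeff a b n) t
        = ∑' n : ℕ, ((n : ℝ) * t ^ (n - 1)) • affineCoeff a b n := e
    rw [e']
    exact key

end AffineODE

/-! ### Quantum annealing on a graph

The qubits are indexed by the vertices, a computational basis state is a bit string `V → Bool`
and operators are matrices indexed by bit strings; norms of operators are operator norms for the
Euclidean norm. The vertex set is linearly ordered: an edge is written `⟨i, j⟩` with `i < j`, so
that the edge cost `u (x i) (x j)` is meaningful also when `u` is not symmetric. -/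

section Annealing

variable {V : Type*} [Fintype V] [LinearOrder V]

open Classical in
/-- `C(x) = ∑ᵢ v(xᵢ) + ∑_{⟨i,j⟩ ∈ E} u(xᵢ, xⱼ)`. -/
noncomputable def cost (v : Bool → ℝ) (u : Bool → Bool → ℝ) (G : SimpleGraph V)
    (x : V → Bool) : ℝ :=
  ∑ i, v (x i) + ∑ i, ∑ j, if i < j ∧ G.Adj i j then u (x i) (x j) else 0

/-- The bit-flip (Pauli `X`) operator on qubit `i`. -/
def bitFlip (i : V) : Matrix (V → Bool) (V → Bool) ℂ :=
  Matrix.of fun x y => if x = Function.update y i (!y i) then 1 else 0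

/-- `H₀ = -∑ᵢ Xᵢ`. -/
def initialHamiltonian (V : Type*) [Fintype V] [LinearOrder V] :
    Matrix (V → Bool) (V → Bool) ℂ :=
  -∑ i, bitFlip i

/-- `H₁ |x⟩ = -C(x) |x⟩`. -/
noncomputable def targetHamiltonian (v : Bool → ℝ) (u : Bool → Bool → ℝ) (G : SimpleGraph V) :
    Matrix (V → Bool) (V → Bool) ℂ :=
  Matrix.diagonal fun x => -(cost v u G x : ℂ)

/-- `H(t) = (1 - t/T) H₀ + (t/T) H₁`. -/
noncomputable def hamiltonian (v : Bool → ℝ) (u : Bool → Bool → ℝ) (G : SimpleGraph V)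
    (T t : ℝ) : Matrix (V → Bool) (V → Bool) ℂ :=
  (1 - t / T) • initialHamiltonian V + (t / T) • targetHamiltonian v u G

/-- The Schrödinger equation `i dU/dt = H(t) U` for the evolution operator, with `U(0) = I`.
The Hamiltonian is extended by its formula beyond `[0, T]`; this does not affect `U` there. -/
def IsEvolution (H U : ℝ → Matrix (V → Bool) (V → Bool) ℂ) : Prop :=
  U 0 = 1 ∧ ∀ t, HasDerivAt U ((-Complex.I) • (H t * U t)) t

theorem exists_isEvolution (v : Bool → ℝ) (u : Bool → Bool → ℝ) (G : SimpleGraph V) (T : ℝ) :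
    ∃ U, IsEvolution (hamiltonian v u G T) U := by
  obtain ⟨U, h0, h⟩ := exists_affine_solution ((-Complex.I) • initialHamiltonian V)
    ((-Complex.I) • (T⁻¹ • (targetHamiltonian v u G - initialHamiltonian V)))
  refine ⟨U, h0, fun t => ?_⟩
  have e : (-Complex.I) • (hamiltonian v u G T t * U t)
      = ((-Complex.I) • initialHamiltonian V +
        t • ((-Complex.I) • (T⁻¹ • (targetHamiltonian v u G - initialHamiltonian V)))) * U t := by
    rw [← smul_mul_assoc, smul_comm t (-Complex.I), ← smul_add, hamiltonian]
    congr 2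
    module
  rw [e]
  exact h t

/-- The evolution operator `U_{0,t}` of the annealing on `G` with running time `T`. -/
noncomputable def evolution (v : Bool → ℝ) (u : Bool → Bool → ℝ) (G : SimpleGraph V) (T : ℝ) :
    ℝ → Matrix (V → Bool) (V → Bool) ℂ :=
  Classical.choose (exists_isEvolution v u G T)

theorem evolution_spec (v : Bool → ℝ) (u : Bool → Bool → ℝ) (G : SimpleGraph V) (T : ℝ) :
    IsEvolution (hamiltonian v u G T) (evolution v u G T) :=
  Classical.choose_spec (exists_isEvolution v u G T)

/-- The uniform superposition of all bit strings. -/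
noncomputable def uniformState (V : Type*) [Fintype V] : (V → Bool) → ℂ :=
  fun _ => ((Real.sqrt 2 : ℝ) : ℂ)⁻¹ ^ Fintype.card V

/-- The final state `|ψ^G(T)⟩ = U_{0,T} |ψ₀⟩`. -/
noncomputable def finalState (v : Bool → ℝ) (u : Bool → Bool → ℝ) (G : SimpleGraph V) (T : ℝ) :
    (V → Bool) → ℂ :=
  Matrix.mulVec (evolution v u G T T) (uniformState V)

/-- The expected value `⟨ψ^G(T)| A |ψ^G(T)⟩`. -/
noncomputable def expectedValue (v : Bool → ℝ) (u : Bool → Bool → ℝ) (G : SimpleGraph V) (T : ℝ)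
    (A : Matrix (V → Bool) (V → Bool) ℂ) : ℂ :=
  dotProduct (star (finalState v u G T)) (Matrix.mulVec A (finalState v u G T))

/-- The Heisenberg-evolved operator `U_{0,T}† A U_{0,T}`. -/
noncomputable def heisenberg (v : Bool → ℝ) (u : Bool → Bool → ℝ) (G : SimpleGraph V) (T : ℝ)
    (A : Matrix (V → Bool) (V → Bool) ℂ) : Matrix (V → Bool) (V → Bool) ℂ :=
  (evolution v u G T T).conjTranspose * A * evolution v u G T T

end Annealing

open Classical in
/-- For an injection `f : ι → V` of qubits, the operator `O ⊗ I` that acts as `O` on the qubits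
in the range of `f` and as the identity on all others. -/
noncomputable def extendOp {ι V : Type*} (f : ι → V) (O : Matrix (ι → Bool) (ι → Bool) ℂ) :
    Matrix (V → Bool) (V → Bool) ℂ :=
  Matrix.of fun x y => if ∀ i, i ∉ Set.range f → x i = y i then O (x ∘ f) (y ∘ f) else 0

/-! ### Neighbourhoods in a graph -/

section Neighbourhood

variable {V : Type*} {G : SimpleGraph V}

/-- The neighbourhood at distance `r` of a subgraph `X`: it contains `X` and all the vertices and
edges that lie on a path of `G` of length at most `r` with an end-point in `X`. -/
def ball (X : G.Subgraph) (r : ℕ) : G.Subgraph where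
  verts := X.verts ∪ {w | ∃ a ∈ X.verts, ∃ b, ∃ p : G.Walk a b,
    p.IsPath ∧ p.length ≤ r ∧ w ∈ p.support}
  Adj w z := X.Adj w z ∨ ∃ a ∈ X.verts, ∃ b, ∃ p : G.Walk a b,
    p.IsPath ∧ p.length ≤ r ∧ s(w, z) ∈ p.edges
  adj_sub := by
    rintro w z (h | ⟨a, -, b, p, -, -, h⟩)
    · exact X.adj_sub h
    · exact p.adj_of_mem_edges h
  edge_vert := by
    rintro w z (h | ⟨a, ha, b, p, hp, hl, h⟩)
    · exact Or.inl (X.edge_vert h)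
    · exact Or.inr ⟨a, ha, b, p, hp, hl, p.fst_mem_support_of_mem_edges h⟩
  symm := ⟨by
    rintro w z (h | ⟨a, ha, b, p, hp, hl, h⟩)
    · exact Or.inl h.symm
    · exact Or.inr ⟨a, ha, b, p, hp, hl, by rwa [Sym2.eq_swap]⟩⟩

theorem verts_subset_ball (X : G.Subgraph) (r : ℕ) : X.verts ⊆ (ball X r).verts :=
  Set.subset_union_left

noncomputable instance fintypeVerts [Finite V] (Y : G.Subgraph) : Fintype Y.verts :=
  Fintype.ofFinite _

end Neighbourhood

end QuantumAnnealing

/-!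
Let `W_s = U^{B_r}_{0,s} ⊗ I`. The derivative of `W_s† (U_s U_T† O U_T U_s†) W_s` in `s` is a
conjugated commutator of the operator in brackets with the terms of `H(s)` that are missing from
`B_r`. Each of them is a combination of products of bit flips and occupation numbers of the qubits
involved, so it suffices that the commutators of these with the evolved observable are small at
distance `r` from `X`.

Their norms, summed with the weights `e^{μ dist(X, ·)}`, grow at most at a rate `κ` which depends on
the strength and the number of the terms at a vertex, but not on the size of the graph: this is a
Grönwall estimate, since a term couples only adjacent qubits and the double commutators it
produces obey the Jacobi identity. The missing terms sit where the weight is `e^{μ r}`; hence the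
two evolved observables differ by `O(‖O‖ T e^{κ T - μ r})`, and the factor `T e^{κ T}` is absorbed
by increasing `μ` by one and taking `r ≥ (κ + 1) T`.

Finally, in the uniform superposition an operator `A ⊗ I` has the same expected value as `A` in the
uniform superposition of the smaller set of qubits, so that expected values differ by no more than
the evolved observables do.
-/

namespace QuantumAnnealing

section Gronwall

variable {ι E : Type*} [Fintype ι] [NormedAddCommGroup E] [NormedSpace ℝ E]

theorem sum_norm_le_mul_exp_of_sum_norm_deriv_le {f f' : ι → ℝ → E} {κ T s : ℝ}
    (hf : ∀ i s, HasDerivAt (f i) (f' i s) s)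
    (bound : ∀ s ∈ Set.Icc 0 T, ∑ i, ‖f' i s‖ ≤ κ * ∑ i, ‖f i s‖) (hs : s ∈ Set.Icc 0 T) :
    ∑ i, ‖f i s‖ ≤ (∑ i, ‖f i T‖) * Real.exp (κ * (T - s)) := by
  -- Grönwall's inequality for the time reversal of `f`, a curve in `ℓ¹`.
  let g : ℝ → PiLp 1 fun _ : ι => E := fun τ => WithLp.toLp 1 fun i => f i (T - τ)
  let g' : ℝ → PiLp 1 fun _ : ι => E := fun τ => WithLp.toLp 1 fun i => -f' i (T - τ)
  have hg τ : HasDerivAt g (g' τ) τ := by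
    have h : HasDerivAt (fun τ i => f i (T - τ)) (fun i => -f' i (T - τ)) τ :=
      hasDerivAt_pi.2 fun i => (hf i (T - τ)).comp_const_sub T τ
    exact (PiLp.continuousLinearEquiv 1 ℝ fun _ : ι => E).symm.hasFDerivAt.comp_hasDerivAt τ h
  have hbound : ∀ τ ∈ Set.Ico 0 T, ‖g' τ‖ ≤ κ * ‖g τ‖ + 0 := fun τ hτ => by
    simpa [PiLp.norm_eq_of_L1, g, g'] using bound (T - τ) ⟨by linarith [hτ.2], by linarith [hτ.1]⟩
  have key := norm_le_gronwallBound_of_norm_deriv_right_le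
    (fun τ _ => (hg τ).continuousAt.continuousWithinAt) (fun τ _ => (hg τ).hasDerivWithinAt)
    le_rfl hbound (T - s) ⟨by linarith [hs.2], by linarith [hs.1]⟩
  rw [gronwallBound_ε0] at key
  simpa [PiLp.norm_eq_of_L1, g] using key

end Gronwall

section NormedRing

variable {A : Type*} [NormedRing A]

theorem norm_lie_le (a b : A) : ‖⁅a, b⁆‖ ≤ 2 * ‖a‖ * ‖b‖ :=
  calc ‖⁅a, b⁆‖ ≤ ‖a * b‖ + ‖b * a‖ := norm_sub_le _ _
    _ ≤ ‖a‖ * ‖b‖ + ‖b‖ * ‖a‖ := add_le_add (norm_mul_le _ _) (norm_mul_le _ _)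
    _ = 2 * ‖a‖ * ‖b‖ := by ring

theorem norm_lie_lie_le (h p a : A) :
    ‖⁅⁅h, p⁆, a⁆‖ ≤ 2 * ‖h‖ * ‖⁅p, a⁆‖ + 2 * ‖p‖ * ‖⁅h, a⁆‖ := by
  let : LieRing A := LieRing.ofAssociativeRing
  rw [lie_lie]
  exact (norm_sub_le _ _).trans (add_le_add (norm_lie_le _ _) (norm_lie_le _ _))

theorem norm_mul_lie_le (p q a : A) : ‖⁅p * q, a⁆‖ ≤ ‖p‖ * ‖⁅q, a⁆‖ + ‖⁅p, a⁆‖ * ‖q‖ := by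
  have leibniz : ⁅p * q, a⁆ = p * ⁅q, a⁆ + ⁅p, a⁆ * q := by
    simp only [Ring.lie_def]
    noncomm_ring
  rw [leibniz]
  exact (norm_add_le _ _).trans (add_le_add (norm_mul_le _ _) (norm_mul_le _ _))

variable {V β I : Type*} [Fintype β]

/-- How strongly `a` acts at the site `w`, measured by its commutators with the elements `P w b`
that generate the operators at `w`. -/
def oscillation (P : V → β → A) (w : V) (a : A) : ℝ :=
  ∑ b, ‖⁅P w b, a⁆‖

theorem oscillation_nonneg (P : V → β → A) (w : V) (a : A) : 0 ≤ oscillation P w a :=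
  Finset.sum_nonneg fun _ _ => norm_nonneg _

theorem norm_lie_le_oscillation (P : V → β → A) (w : V) (b : β) (a : A) :
    ‖⁅P w b, a⁆‖ ≤ oscillation P w a :=
  Finset.single_le_sum (f := fun b => ‖⁅P w b, a⁆‖) (fun _ _ => norm_nonneg _)
    (Finset.mem_univ b)

/-- The total oscillation of `a`, a site `w` counting with the weight `q w`. For weights that grow
with the distance from a region, its smallness expresses that `a` is concentrated there. -/
def weightedOscillation [Fintype V] (P : V → β → A) (q : V → ℝ) (a : A) : ℝ :=
  ∑ w, q w * oscillation P w a

/-- `h` is an interaction of strength at most `K` among the sites in `S`: besides `‖h‖ ≤ K`, its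
commutators are controlled by oscillations at `S`, and it commutes with the generators elsewhere. -/
structure IsLocalTerm (P : V → β → A) (K : ℝ) (S : Finset V) (h : A) : Prop where
  norm_le : ‖h‖ ≤ K
  norm_lie_le (a : A) : ‖⁅h, a⁆‖ ≤ K * ∑ i ∈ S, oscillation P i a
  commute_generator (w : V) (hw : w ∉ S) (b : β) : Commute h (P w b)

theorem isLocalTerm_one [NormOneClass A] (P : V → β → A) (S : Finset V) :
    IsLocalTerm P 1 S 1 where
  norm_le := norm_one.le
  norm_lie_le a := by
    rw [(Commute.one_left a).lie_eq, norm_zero, one_mul]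
    exact Finset.sum_nonneg fun i _ => oscillation_nonneg P i a
  commute_generator w _ b := Commute.one_left _

theorem isLocalTerm_generator {P : V → β → A} {i : V} {b : β} (hP : ‖P i b‖ ≤ 1)
    (hcomm : ∀ w ≠ i, ∀ c, Commute (P i b) (P w c)) : IsLocalTerm P 1 {i} (P i b) where
  norm_le := hP
  norm_lie_le a := by
    rw [one_mul, Finset.sum_singleton]
    exact norm_lie_le_oscillation P i b a
  commute_generator w hw := hcomm w (Finset.notMem_singleton.1 hw)

namespace IsLocalTerm

variable {P : V → β → A} {K K' : ℝ} {S S' : Finset V} {h h' : A}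

theorem mono (L : IsLocalTerm P K S h) (hK : K ≤ K') (hS : S ⊆ S') : IsLocalTerm P K' S' h where
  norm_le := L.norm_le.trans hK
  norm_lie_le a := by
    refine (L.norm_lie_le a).trans ?_
    have hK' : 0 ≤ K' := ((norm_nonneg h).trans L.norm_le).trans hK
    have hosc (i : V) : 0 ≤ oscillation P i a := oscillation_nonneg P i a
    gcongr
    exacts [Finset.sum_nonneg fun i _ => hosc i, fun i _ _ => hosc i]
  commute_generator w hw := L.commute_generator w (mt (hS ·) hw)

theorem add (L : IsLocalTerm P K S h) (L' : IsLocalTerm P K' S h') :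
    IsLocalTerm P (K + K') S (h + h') where
  norm_le := norm_add_le_of_le L.norm_le L'.norm_le
  norm_lie_le a := by
    let : LieRing A := LieRing.ofAssociativeRing
    rw [add_lie, add_mul]
    exact norm_add_le_of_le (L.norm_lie_le a) (L'.norm_lie_le a)
  commute_generator w hw b := (L.commute_generator w hw b).add_left (L'.commute_generator w hw b)

theorem smul {𝕜 : Type*} [NormedField 𝕜] [NormedAlgebra 𝕜 A] (c : 𝕜) (L : IsLocalTerm P K S h) :
    IsLocalTerm P (‖c‖ * K) S (c • h) where
  norm_le := by
    rw [norm_smul]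
    gcongr
    exact L.norm_le
  norm_lie_le a := by
    rw [Ring.lie_def, smul_mul_assoc, mul_smul_comm, ← smul_sub, ← Ring.lie_def, norm_smul,
      mul_assoc]
    gcongr
    exact L.norm_lie_le a
  commute_generator w hw b := (L.commute_generator w hw b).smul_left c

theorem mul [DecidableEq V] (L : IsLocalTerm P K S h) (L' : IsLocalTerm P K' S' h')
    (hS : Disjoint S S') : IsLocalTerm P (K * K') (S ∪ S') (h * h') where
  norm_le := norm_mul_le_of_le L.norm_le L'.norm_le
  norm_lie_le a := by
    have hK : 0 ≤ K := (norm_nonneg h).trans L.norm_le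
    have hosc : 0 ≤ K * ∑ i ∈ S, oscillation P i a := (norm_nonneg _).trans (L.norm_lie_le a)
    calc ‖⁅h * h', a⁆‖ ≤ ‖h‖ * ‖⁅h', a⁆‖ + ‖⁅h, a⁆‖ * ‖h'‖ := norm_mul_lie_le h h' a
      _ ≤ K * (K' * ∑ i ∈ S', oscillation P i a) + K * (∑ i ∈ S, oscillation P i a) * K' := by
        gcongr
        exacts [L.norm_le, L'.norm_lie_le a, L.norm_lie_le a, L'.norm_le]
      _ = K * K' * ∑ i ∈ S ∪ S', oscillation P i a := by
        rw [Finset.sum_union hS]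
        ring
  commute_generator w hw b :=
    (L.commute_generator w (mt (Finset.mem_union_left S') hw) b).mul_left
      (L'.commute_generator w (mt (Finset.mem_union_right S) hw) b)

theorem sum_norm_lie_lie_le (L : IsLocalTerm P K S h) (hP : ∀ w b, ‖P w b‖ ≤ 1) (w : V) (a : A) :
    ∑ b, ‖⁅⁅h, P w b⁆, a⁆‖ ≤
      2 * K * (oscillation P w a + Fintype.card β * ∑ i ∈ S, oscillation P i a) :=
  calc ∑ b, ‖⁅⁅h, P w b⁆, a⁆‖
      ≤ ∑ b, (2 * K * ‖⁅P w b, a⁆‖ + 2 * 1 * (K * ∑ i ∈ S, oscillation P i a)) := by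
        gcongr with b
        refine (norm_lie_lie_le h (P w b) a).trans ?_
        gcongr
        exacts [L.norm_le, hP w b, L.norm_lie_le a]
    _ = 2 * K * (oscillation P w a + Fintype.card β * ∑ i ∈ S, oscillation P i a) := by
        rw [Finset.sum_add_distrib, ← Finset.mul_sum, Finset.sum_const, Finset.card_univ,
          nsmul_eq_mul, oscillation]
        ring

theorem sum_norm_lie_lie_eq_zero (L : IsLocalTerm P K S h) {w : V} (hw : w ∉ S) (a : A) :
    ∑ b, ‖⁅⁅h, P w b⁆, a⁆‖ = 0 :=
  Finset.sum_eq_zero fun b _ => by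
    let : LieRing A := LieRing.ofAssociativeRing
    rw [(L.commute_generator w hw b).lie_eq, zero_lie, norm_zero]

theorem sum_weight_mul_norm_lie_lie_le [Fintype V] (L : IsLocalTerm P K S h)
    (hP : ∀ w b, ‖P w b‖ ≤ 1) {q : V → ℝ} (hq : ∀ w, 0 ≤ q w) {l : ℝ} {s : ℕ} (hs : S.card ≤ s)
    (hl₀ : 0 ≤ l) (hl : ∀ i ∈ S, ∀ j ∈ S, q i ≤ l * q j) (a : A) :
    ∑ w, q w * ∑ b, ‖⁅⁅h, P w b⁆, a⁆‖ ≤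
      2 * K * (1 + Fintype.card β * s * l) * ∑ i ∈ S, q i * oscillation P i a := by
  have hK : 0 ≤ K := (norm_nonneg h).trans L.norm_le
  have sum_weight_le : ∀ i ∈ S, ∑ w ∈ S, q w ≤ s * l * q i := fun i hi =>
    calc ∑ w ∈ S, q w ≤ S.card • (l * q i) :=
        Finset.sum_le_card_nsmul _ _ _ fun w hw => hl w hw i hi
      _ ≤ s * l * q i := by
        rw [nsmul_eq_mul, ← mul_assoc]
        gcongr
        exact hq i
  have cross_le : (∑ w ∈ S, q w) * ∑ i ∈ S, oscillation P i a ≤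
      s * l * ∑ i ∈ S, q i * oscillation P i a := by
    rw [Finset.mul_sum, Finset.mul_sum]
    refine Finset.sum_le_sum fun i hi => ?_
    rw [← mul_assoc]
    exact mul_le_mul_of_nonneg_right (sum_weight_le i hi) (oscillation_nonneg P i a)
  calc ∑ w, q w * ∑ b, ‖⁅⁅h, P w b⁆, a⁆‖
      = ∑ w ∈ S, q w * ∑ b, ‖⁅⁅h, P w b⁆, a⁆‖ :=
        (Finset.sum_subset S.subset_univ fun w _ hw => by
          rw [L.sum_norm_lie_lie_eq_zero hw, mul_zero]).symm
    _ ≤ ∑ w ∈ S, q w *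
          (2 * K * (oscillation P w a + Fintype.card β * ∑ i ∈ S, oscillation P i a)) := by
        gcongr with w
        exacts [hq w, L.sum_norm_lie_lie_le hP w a]
    _ = 2 * K * (∑ w ∈ S, q w * oscillation P w a +
          Fintype.card β * ((∑ w ∈ S, q w) * ∑ i ∈ S, oscillation P i a)) := by
        simp only [mul_left_comm (q _), mul_add, ← Finset.mul_sum, Finset.sum_add_distrib,
          ← Finset.sum_mul]
    _ ≤ 2 * K * (∑ w ∈ S, q w * oscillation P w a +
          Fintype.card β * (s * l * ∑ i ∈ S, q i * oscillation P i a)) := by gcongr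
    _ = 2 * K * (1 + Fintype.card β * s * l) * ∑ i ∈ S, q i * oscillation P i a := by ring

end IsLocalTerm

theorem sum_sum_le_mul_sum_of_card_filter_le [Fintype V] [DecidableEq V] {F : Finset I}
    {S : I → Finset V} {N : ℕ} (hN : ∀ w, {k ∈ F | w ∈ S k}.card ≤ N) {f : V → ℝ}
    (hf : ∀ w, 0 ≤ f w) : ∑ k ∈ F, ∑ i ∈ S k, f i ≤ N * ∑ w, f w :=
  calc ∑ k ∈ F, ∑ i ∈ S k, f i = ∑ w, ∑ k ∈ F with w ∈ S k, f w :=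
        Finset.sum_comm' fun k w => by simp
    _ ≤ ∑ w, N * f w := by
        gcongr with w
        rw [Finset.sum_const, nsmul_eq_mul]
        gcongr
        exacts [hf w, hN w]
    _ = N * ∑ w, f w := (Finset.mul_sum _ _ _).symm

/-- The terms `h k`, `k ∈ F`, of a Hamiltonian on a lattice of sites, generated at the site `w` by
the contractions `P w b`: each has strength at most `K` and involves at most `s` sites, given by
`S k`, and each site takes part in at most `N` of them. -/
structure IsLocalFamily [DecidableEq V] (P : V → β → A) (K : ℝ) (s N : ℕ) (F : Finset I)
    (S : I → Finset V) (h : I → A) : Prop where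
  norm_generator_le (w : V) (b : β) : ‖P w b‖ ≤ 1
  isLocalTerm (k : I) (hk : k ∈ F) : IsLocalTerm P K (S k) (h k)
  card_support_le (k : I) (hk : k ∈ F) : (S k).card ≤ s
  card_terms_le (w : V) : {k ∈ F | w ∈ S k}.card ≤ N

/-- The Lieb–Robinson rate: with the parameters of `IsLocalFamily`, `c` generators per site and
weights that vary by at most a factor `l` on each term, weighted oscillations grow at most at this
exponential rate. -/
def growthRate (K : ℝ) (s N c : ℕ) (l : ℝ) : ℝ :=
  2 * K * N * (1 + c * s * l)

theorem growthRate_nonneg {K l : ℝ} (hK : 0 ≤ K) (hl : 0 ≤ l) (s N c : ℕ) :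
    0 ≤ growthRate K s N c l := by
  unfold growthRate
  positivity

namespace IsLocalFamily

variable [DecidableEq V] {P : V → β → A} {K : ℝ} {s N : ℕ} {F F' : Finset I}
  {S : I → Finset V} {h : I → A}

theorem mono (L : IsLocalFamily P K s N F S h) (hF : F' ⊆ F) : IsLocalFamily P K s N F' S h where
  norm_generator_le := L.norm_generator_le
  isLocalTerm k hk := L.isLocalTerm k (hF hk)
  card_support_le k hk := L.card_support_le k (hF hk)
  card_terms_le w := (Finset.card_le_card (Finset.filter_subset_filter _ hF)).trans
    (L.card_terms_le w)

variable [Fintype V] {q : V → ℝ}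

theorem sum_weight_mul_norm_lie_lie_le (L : IsLocalFamily P K s N F S h) (hq : ∀ w, 0 ≤ q w)
    {l : ℝ} (hK : 0 ≤ K) (hl₀ : 0 ≤ l) (hl : ∀ k ∈ F, ∀ i ∈ S k, ∀ j ∈ S k, q i ≤ l * q j) (a : A) :
    ∑ w, q w * ∑ b, ‖⁅⁅∑ k ∈ F, h k, P w b⁆, a⁆‖ ≤
      growthRate K s N (Fintype.card β) l * weightedOscillation P q a :=
  calc ∑ w, q w * ∑ b, ‖⁅⁅∑ k ∈ F, h k, P w b⁆, a⁆‖
      ≤ ∑ w, q w * ∑ b, ∑ k ∈ F, ‖⁅⁅h k, P w b⁆, a⁆‖ := by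
        gcongr with w _ b
        · exact hq w
        · let : LieRing A := LieRing.ofAssociativeRing
          simp only [sum_lie]
          exact norm_sum_le _ _
    _ = ∑ k ∈ F, ∑ w, q w * ∑ b, ‖⁅⁅h k, P w b⁆, a⁆‖ := by
        rw [Finset.sum_comm]
        refine Finset.sum_congr rfl fun w _ => ?_
        rw [Finset.sum_comm, Finset.mul_sum]
    _ ≤ ∑ k ∈ F, 2 * K * (1 + Fintype.card β * s * l) * ∑ i ∈ S k, q i * oscillation P i a := by
        gcongr with k hk
        exact (L.isLocalTerm k hk).sum_weight_mul_norm_lie_lie_le L.norm_generator_le hq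
          (L.card_support_le k hk) hl₀ (hl k hk) a
    _ ≤ 2 * K * (1 + Fintype.card β * s * l) * (N * ∑ w, q w * oscillation P w a) := by
        rw [← Finset.mul_sum]
        gcongr
        exact sum_sum_le_mul_sum_of_card_filter_le L.card_terms_le fun w =>
          mul_nonneg (hq w) (oscillation_nonneg P w a)
    _ = growthRate K s N (Fintype.card β) l * weightedOscillation P q a := by
        rw [growthRate, weightedOscillation]
        ring

theorem norm_sum_lie_le (L : IsLocalFamily P K s N F S h) (hq : ∀ w, 0 ≤ q w) {R : ℝ} (hK : 0 ≤ K)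
    (hR₀ : 0 < R) (hR : ∀ k ∈ F, ∀ i ∈ S k, R ≤ q i) (a : A) :
    ‖⁅∑ k ∈ F, h k, a⁆‖ ≤ K * N / R * weightedOscillation P q a := by
  have oscillation_le : ∀ k ∈ F, ∀ i ∈ S k,
      oscillation P i a ≤ R⁻¹ * (q i * oscillation P i a) := by
    intro k hk i hi
    rw [← mul_assoc, inv_mul_eq_div]
    exact le_mul_of_one_le_left (oscillation_nonneg P i a) ((one_le_div hR₀).2 (hR k hk i hi))
  calc ‖⁅∑ k ∈ F, h k, a⁆‖ ≤ ∑ k ∈ F, K * ∑ i ∈ S k, oscillation P i a := by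
        let : LieRing A := LieRing.ofAssociativeRing
        rw [sum_lie]
        exact norm_sum_le_of_le _ fun k hk => (L.isLocalTerm k hk).norm_lie_le a
    _ ≤ ∑ k ∈ F, K * ∑ i ∈ S k, R⁻¹ * (q i * oscillation P i a) := by
        gcongr with k hk i hi
        exact oscillation_le k hk i hi
    _ ≤ K * (N * (R⁻¹ * weightedOscillation P q a)) := by
        rw [← Finset.mul_sum, weightedOscillation, Finset.mul_sum _ _ R⁻¹]
        gcongr
        exact sum_sum_le_mul_sum_of_card_filter_le L.card_terms_le fun w =>
          mul_nonneg (inv_nonneg.2 hR₀.le) (mul_nonneg (hq w) (oscillation_nonneg P w a))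
    _ = K * N / R * weightedOscillation P q a := by ring

end IsLocalFamily

end NormedRing

section Schrodinger

variable {A : Type*} [CStarAlgebra A]

/-- `U` is the unitary evolution generated by the self-adjoint Hamiltonian `H`, in an abstract
C⋆-algebra. -/
structure IsSchrodinger (H U : ℝ → A) : Prop where
  zero : U 0 = 1
  hasDerivAt (t : ℝ) : HasDerivAt U ((-Complex.I) • (H t * U t)) t
  isSelfAdjoint (t : ℝ) : IsSelfAdjoint (H t)
  mem_unitary (t : ℝ) : U t ∈ unitary A

variable {H H' U W : ℝ → A}

theorem hasDerivAt_star_of_hasDerivAt {t : ℝ} (hU : HasDerivAt U ((-Complex.I) • (H t * U t)) t)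
    (hH : IsSelfAdjoint (H t)) :
    HasDerivAt (fun t => star (U t)) (Complex.I • (star (U t) * H t)) t := by
  simpa [star_smul, hH.star_eq] using hU.star

theorem star_mul_self_eq_one_of_hasDerivAt (h₀ : U 0 = 1)
    (hU : ∀ t, HasDerivAt U ((-Complex.I) • (H t * U t)) t) (hH : ∀ t, IsSelfAdjoint (H t))
    (t : ℝ) : star (U t) * U t = 1 := by
  have hderiv t : HasDerivAt (fun t => star (U t) * U t) 0 t :=
    ((hasDerivAt_star_of_hasDerivAt (hU t) (hH t)).mul (hU t)).congr_deriv (by simp [mul_assoc])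
  have hconst := is_const_of_deriv_eq_zero (fun t => (hderiv t).differentiableAt)
    (fun t => (hderiv t).deriv) t 0
  simpa [h₀] using hconst

theorem norm_star_mul_mul_of_mem_unitary {w : A} (hw : w ∈ unitary A) (a : A) :
    ‖star w * a * w‖ = ‖a‖ := by
  rw [CStarRing.norm_mul_mem_unitary _ hw,
    CStarRing.norm_mem_unitary_mul _ (Unitary.star_mem hw)]

theorem norm_lie_star_mul_mul {w : A} (hw : w ∈ unitary A) (p a : A) :
    ‖⁅star w * p * w, a⁆‖ = ‖⁅p, w * a * star w⁆‖ := by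
  have conj_lie : star w * ⁅p, w * a * star w⁆ * w =
      star w * p * w * a * (star w * w) - star w * w * a * (star w * p * w) := by
    rw [Ring.lie_def]
    noncomm_ring
  rw [← norm_star_mul_mul_of_mem_unitary hw ⁅p, _⁆, conj_lie, Unitary.star_mul_self_of_mem hw,
    mul_one, one_mul, Ring.lie_def]

namespace IsSchrodinger

theorem hasDerivAt_star (h : IsSchrodinger H U) (t : ℝ) :
    HasDerivAt (fun t => star (U t)) (Complex.I • (star (U t) * H t)) t :=
  hasDerivAt_star_of_hasDerivAt (h.hasDerivAt t) (h.isSelfAdjoint t)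

theorem hasDerivAt_conj (h : IsSchrodinger H U) (p : A) (t : ℝ) :
    HasDerivAt (fun t => star (U t) * p * U t) (Complex.I • (star (U t) * ⁅H t, p⁆ * U t)) t := by
  refine (((h.hasDerivAt_star t).mul_const p).mul (h.hasDerivAt t)).congr_deriv ?_
  simp only [Ring.lie_def, smul_mul_assoc, mul_smul_comm, neg_smul, mul_neg, ← sub_eq_add_neg,
    ← smul_sub]
  congr 1
  noncomm_ring

theorem map {B : Type*} [CStarAlgebra B] (h : IsSchrodinger H U) (φ : A →⋆ₐ[ℂ] B) :
    IsSchrodinger (fun t => φ (H t)) fun t => φ (U t) where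
  zero := by rw [h.zero, map_one]
  hasDerivAt t := by
    have φ_cont : Continuous φ := open scoped CStarAlgebra in map_continuous φ
    let φL : A →L[ℝ] B := ⟨φ.toLinearMap.restrictScalars ℝ, φ_cont⟩
    refine (φL.hasFDerivAt.comp_hasDerivAt t (h.hasDerivAt t)).congr_deriv ?_
    change φ _ = _
    simp
  isSelfAdjoint t := (h.isSelfAdjoint t).map φ
  mem_unitary t := Unitary.map_mem φ (h.mem_unitary t)

variable {V β I : Type*} [Fintype β] [Fintype V] {P : V → β → A} {q : V → ℝ} {κ T s : ℝ}

/- In the Heisenberg picture the commutator of an evolved generator with the fixed `a` has a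
derivative that is again controlled by oscillations, so Grönwall's inequality applies; `U s`
being unitary, it does not matter whether the generator or `a` is evolved. -/
theorem weightedOscillation_le (hU : IsSchrodinger H U) (hq : ∀ w, 0 ≤ q w)
    (hκ : ∀ s ∈ Set.Icc 0 T, ∀ a,
      ∑ w, q w * ∑ b, ‖⁅⁅H s, P w b⁆, a⁆‖ ≤ κ * weightedOscillation P q a)
    (hs : s ∈ Set.Icc 0 T) (a : A) :
    weightedOscillation P q (U s * a * star (U s)) ≤
      weightedOscillation P q (U T * a * star (U T)) * Real.exp (κ * (T - s)) := by
  let f (i : V × β) (s : ℝ) : A := q i.1 • ⁅star (U s) * P i.1 i.2 * U s, a⁆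
  let f' (i : V × β) (s : ℝ) : A :=
    q i.1 • Complex.I • ⁅star (U s) * ⁅H s, P i.1 i.2⁆ * U s, a⁆
  have hf i s : HasDerivAt (f i) (f' i s) s := by
    have hconj := hU.hasDerivAt_conj (P i.1 i.2) s
    refine (((hconj.mul_const a).sub (hconj.const_mul a)).const_smul (q i.1)).congr_deriv ?_
    simp only [f', Ring.lie_def, smul_mul_assoc, mul_smul_comm, smul_sub]
  have norm_f s : ∑ i, ‖f i s‖ = weightedOscillation P q (U s * a * star (U s)) := by
    simp only [f, Fintype.sum_prod_type, norm_smul, Real.norm_of_nonneg (hq _),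
      weightedOscillation, oscillation, Finset.mul_sum, norm_lie_star_mul_mul (hU.mem_unitary s)]
  have norm_f' s : ∑ i, ‖f' i s‖ =
      ∑ w, q w * ∑ b, ‖⁅⁅H s, P w b⁆, U s * a * star (U s)⁆‖ := by
    simp only [f', Fintype.sum_prod_type, norm_smul, Real.norm_of_nonneg (hq _), Complex.norm_I,
      one_mul, Finset.mul_sum, norm_lie_star_mul_mul (hU.mem_unitary s)]
  rw [← norm_f, ← norm_f]
  refine sum_norm_le_mul_exp_of_sum_norm_deriv_le hf (fun s hs => ?_) hs
  rw [norm_f, norm_f']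
  exact hκ s hs _

theorem norm_conj_sub_conj_le (hU : IsSchrodinger H U) (hW : IsSchrodinger H' W) {C : ℝ}
    (hT : 0 ≤ T) (a : A) (hC : ∀ s ∈ Set.Ico 0 T, ‖⁅H s - H' s, U s * a * star (U s)⁆‖ ≤ C) :
    ‖a - star (W T) * (U T * a * star (U T)) * W T‖ ≤ C * T := by
  let f (s : ℝ) : A := star (W s) * (U s * a * star (U s)) * W s
  let f' (s : ℝ) : A :=
    -Complex.I • (star (W s) * ⁅H s - H' s, U s * a * star (U s)⁆ * W s)
  have hf s : HasDerivAt f (f' s) s := by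
    have hconj := ((hU.hasDerivAt s).mul_const a).mul (hU.hasDerivAt_star s)
    refine (((hW.hasDerivAt_star s).mul hconj).mul (hW.hasDerivAt s)).congr_deriv ?_
    simp only [f', Ring.lie_def, Pi.mul_apply, smul_mul_assoc, mul_smul_comm, neg_smul,
      ← smul_neg, ← smul_add]
    congr 1
    noncomm_ring
  have norm_f' : ∀ s ∈ Set.Ico 0 T, ‖f' s‖ ≤ C := fun s hs => by
    rw [norm_smul, norm_neg, Complex.norm_I, one_mul,
      norm_star_mul_mul_of_mem_unitary (hW.mem_unitary s)]
    exact hC s hs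
  simpa [f, hU.zero, hW.zero, norm_sub_rev] using
    norm_image_sub_le_of_norm_deriv_le_segment' (fun s _ => (hf s).hasDerivWithinAt) norm_f' T
      ⟨hT, le_rfl⟩

theorem norm_conj_sub_conj_le_of_isLocalFamily [DecidableEq I] [DecidableEq V] {K l R : ℝ}
    {n N : ℕ} {F F' : Finset I} {S : I → Finset V} {h : ℝ → I → A}
    (hU : IsSchrodinger (fun t => ∑ k ∈ F, h t k) U)
    (hW : IsSchrodinger (fun t => ∑ k ∈ F', h t k) W) (hF : F' ⊆ F) (hT : 0 ≤ T)
    (L : ∀ t ∈ Set.Icc 0 T, IsLocalFamily P K n N F S (h t)) (hK : 0 ≤ K) (hq : ∀ w, 0 ≤ q w)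
    (hl₀ : 0 ≤ l) (hl : ∀ k ∈ F, ∀ i ∈ S k, ∀ j ∈ S k, q i ≤ l * q j) (hR₀ : 0 < R)
    (hR : ∀ k ∈ F \ F', ∀ i ∈ S k, R ≤ q i) (o : A) :
    ‖star (U T) * o * U T - star (W T) * o * W T‖ ≤ K * N / R *
      (weightedOscillation P q o * Real.exp (growthRate K n N (Fintype.card β) l * T)) * T := by
  set κ := growthRate K n N (Fintype.card β) l
  have conj_conj : U T * (star (U T) * o * U T) * star (U T) = o := by
    have hUU := Unitary.mul_star_self_of_mem (hU.mem_unitary T)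
    rw [← mul_assoc, ← mul_assoc, hUU, one_mul, mul_assoc, hUU, mul_one]
  have oscillation_le : ∀ s ∈ Set.Ico 0 T,
      weightedOscillation P q (U s * (star (U T) * o * U T) * star (U s)) ≤
        weightedOscillation P q o * Real.exp (κ * T) := fun s hs => by
    refine (hU.weightedOscillation_le hq (fun s hs a =>
      (L s hs).sum_weight_mul_norm_lie_lie_le hq hK hl₀ hl a) (Set.Ico_subset_Icc_self hs)
      _).trans ?_
    rw [conj_conj]
    have hκ : 0 ≤ κ := growthRate_nonneg hK hl₀ n N _
    have ho : 0 ≤ weightedOscillation P q o :=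
      Finset.sum_nonneg fun w _ => mul_nonneg (hq w) (oscillation_nonneg P w o)
    gcongr
    linarith [hs.1]
  have norm_lie_le : ∀ s ∈ Set.Ico 0 T,
      ‖⁅∑ k ∈ F, h s k - ∑ k ∈ F', h s k, U s * (star (U T) * o * U T) * star (U s)⁆‖ ≤
        K * N / R * (weightedOscillation P q o * Real.exp (κ * T)) := fun s hs => by
    rw [← Finset.sum_sdiff_eq_sub hF]
    refine (((L s (Set.Ico_subset_Icc_self hs)).mono Finset.sdiff_subset).norm_sum_lie_le hq hK hR₀
      hR _).trans ?_
    gcongr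
    exact oscillation_le s hs
  simpa only [conj_conj] using hU.norm_conj_sub_conj_le hW hT _ norm_lie_le

end IsSchrodinger

end Schrodinger

section ExtendOp

variable {ι κ V : Type*} {f : ι → V}

open Classical in
theorem extendOp_apply (f : ι → V) (O : Matrix (ι → Bool) (ι → Bool) ℂ) (x y : V → Bool) :
    extendOp f O x y = if ∀ i ∉ Set.range f, x i = y i then O (x ∘ f) (y ∘ f) else 0 :=
  rfl

theorem eq_iff_eq_off_range_and_comp_eq {x y : V → Bool} :
    x = y ↔ (∀ i ∉ Set.range f, x i = y i) ∧ x ∘ f = y ∘ f := by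
  refine ⟨by rintro rfl; simp, fun ⟨eq_off_range, comp_eq⟩ => funext fun i => ?_⟩
  by_cases hi : i ∈ Set.range f
  · obtain ⟨j, rfl⟩ := hi
    exact congrFun comp_eq j
  · exact eq_off_range i hi

theorem extend_eq_iff (hf : f.Injective) {w : ι → Bool} {x z : V → Bool} :
    Function.extend f w x = z ↔ (∀ i ∉ Set.range f, x i = z i) ∧ w = z ∘ f := by
  rw [eq_iff_eq_off_range_and_comp_eq (f := f), Function.extend_comp hf]
  exact and_congr_left fun _ => forall₂_congr fun i hi => by rw [Function.extend_apply' _ _ _ hi]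

theorem sum_extendOp_mul [Fintype ι] [Fintype V] [DecidableEq ι] [DecidableEq V]
    (hf : f.Injective) (O : Matrix (ι → Bool) (ι → Bool) ℂ) (x : V → Bool) (F : (V → Bool) → ℂ) :
    ∑ z, extendOp f O x z * F z = ∑ w, O (x ∘ f) w * F (Function.extend f w x) := by
  classical
  simp only [extendOp_apply, ite_mul, zero_mul]
  rw [← Finset.sum_filter]
  refine Finset.sum_nbij' (· ∘ f) (Function.extend f · x) (by simp) (fun w _ => ?_) (fun z hz => ?_)
    (fun w _ => Function.extend_comp hf _ _) (fun z hz => ?_)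
  · exact Finset.mem_filter.2 ⟨Finset.mem_univ _, ((extend_eq_iff hf).1 rfl).1⟩
  · exact (extend_eq_iff hf).2 ⟨(Finset.mem_filter.1 hz).2, rfl⟩
  · rw [(extend_eq_iff hf).2 ⟨(Finset.mem_filter.1 hz).2, rfl⟩]

theorem extendOp_mul [Fintype ι] [Fintype V] [DecidableEq ι] [DecidableEq V] (hf : f.Injective)
    (O O' : Matrix (ι → Bool) (ι → Bool) ℂ) :
    extendOp f (O * O') = extendOp f O * extendOp f O' := by
  classical
  ext x y
  have extend_eq_off_range (w : ι → Bool) :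
      (∀ i ∉ Set.range f, Function.extend f w x i = y i) ↔ ∀ i ∉ Set.range f, x i = y i :=
    forall₂_congr fun i hi => by rw [Function.extend_apply' _ _ _ hi]
  rw [Matrix.mul_apply, sum_extendOp_mul hf]
  simp only [extendOp_apply, Function.extend_comp hf, extend_eq_off_range]
  split_ifs
  · rw [Matrix.mul_apply]
  · simp only [mul_zero, Finset.sum_const_zero]

open Classical in
theorem extendOp_mul_extendOp_apply [Fintype V] [DecidableEq V] {g : κ → V}
    (hfg : Disjoint (Set.range f) (Set.range g)) (O : Matrix (ι → Bool) (ι → Bool) ℂ)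
    (O' : Matrix (κ → Bool) (κ → Bool) ℂ) (x y : V → Bool) :
    (extendOp f O * extendOp g O') x y =
      if ∀ i ∉ Set.range f ∪ Set.range g, x i = y i then
        O (x ∘ f) (y ∘ f) * O' (x ∘ g) (y ∘ g) else 0 := by
  -- The only intermediate bit string that contributes agrees with `y` on the range of `f` and
  -- with `x` elsewhere.
  let z₀ : V → Bool := (Set.range f).piecewise y x
  have z₀_comp_f : z₀ ∘ f = y ∘ f := funext fun j => Set.piecewise_eq_of_mem _ _ _ ⟨j, rfl⟩
  have z₀_comp_g : z₀ ∘ g = x ∘ g :=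
    funext fun j => Set.piecewise_eq_of_notMem _ _ _ (hfg.notMem_of_mem_right ⟨j, rfl⟩)
  have z₀_off_f : ∀ i ∉ Set.range f, x i = z₀ i := fun i hi =>
    (Set.piecewise_eq_of_notMem _ _ _ hi).symm
  have z₀_off_g : (∀ i ∉ Set.range g, z₀ i = y i) ↔
      ∀ i ∉ Set.range f ∪ Set.range g, x i = y i := by
    refine ⟨fun h i hi => ?_, fun h i hi => ?_⟩
    · rw [z₀_off_f i (mt Or.inl hi), h i (mt Or.inr hi)]
    · by_cases hif : i ∈ Set.range f
      · exact Set.piecewise_eq_of_mem _ _ _ hif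
      · rw [← z₀_off_f i hif, h i (not_or.2 ⟨hif, hi⟩)]
  have eq_z₀ (z : V → Bool) (hzf : ∀ i ∉ Set.range f, x i = z i)
      (hzg : ∀ i ∉ Set.range g, z i = y i) : z = z₀ := by
    funext i
    by_cases hif : i ∈ Set.range f
    · exact (hzg i (hfg.notMem_of_mem_left hif)).trans (Set.piecewise_eq_of_mem _ _ _ hif).symm
    · rw [← hzf i hif, z₀_off_f i hif]
  rw [Matrix.mul_apply, Finset.sum_eq_single z₀ (fun z _ hz => ?_) (by simp)]
  · simp only [extendOp_apply, if_pos z₀_off_f, z₀_off_g, z₀_comp_f, z₀_comp_g, mul_ite, mul_zero]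
  · simp only [extendOp_apply, ite_mul, zero_mul, mul_ite, mul_zero]
    split_ifs with hzg hzf <;> first | exact absurd (eq_z₀ z ‹_› ‹_›) hz | rfl

theorem commute_extendOp_extendOp [Fintype V] [DecidableEq V] {g : κ → V}
    (hfg : Disjoint (Set.range f) (Set.range g)) (O : Matrix (ι → Bool) (ι → Bool) ℂ)
    (O' : Matrix (κ → Bool) (κ → Bool) ℂ) : Commute (extendOp f O) (extendOp g O') := by
  classical
  ext x y
  simp only [extendOp_mul_extendOp_apply hfg, extendOp_mul_extendOp_apply hfg.symm, Set.union_comm,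
    mul_comm]

theorem extendOp_diagonal [DecidableEq (ι → Bool)] [DecidableEq (V → Bool)] (φ : (ι → Bool) → ℂ) :
    extendOp f (Matrix.diagonal φ) = Matrix.diagonal fun x => φ (x ∘ f) := by
  classical
  ext x y
  simp only [extendOp_apply, Matrix.diagonal_apply,
    eq_iff_eq_off_range_and_comp_eq (x := x) (f := f), ite_and]

theorem extendOp_one [DecidableEq (ι → Bool)] [DecidableEq (V → Bool)] : extendOp f 1 = 1 := by
  rw [← Matrix.diagonal_one, extendOp_diagonal, Matrix.diagonal_one]

theorem extendOp_conjTranspose (O : Matrix (ι → Bool) (ι → Bool) ℂ) :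
    extendOp f O.conjTranspose = (extendOp f O).conjTranspose := by
  classical
  ext x y
  simp only [Matrix.conjTranspose_apply, extendOp_apply, eq_comm (a := x _), apply_ite star,
    star_zero]

theorem extendOp_extendOp {g : κ → ι} (hf : f.Injective) (O : Matrix (κ → Bool) (κ → Bool) ℂ) :
    extendOp f (extendOp g O) = extendOp (f ∘ g) O := by
  classical
  ext x y
  have eq_off_range_comp : (∀ i ∉ Set.range (f ∘ g), x i = y i) ↔
      (∀ i ∉ Set.range f, x i = y i) ∧ ∀ j ∉ Set.range g, (x ∘ f) j = (y ∘ f) j := by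
    rw [Set.range_comp]
    refine ⟨fun h => ⟨fun i hi => h i (mt (Set.image_subset_range f _ ·) hi), fun j hj =>
      h (f j) (hf.mem_set_image.not.2 hj)⟩, fun ⟨off_f, off_g⟩ i hi => ?_⟩
    by_cases hif : i ∈ Set.range f
    · obtain ⟨j, rfl⟩ := hif
      exact off_g j (mt (Set.mem_image_of_mem f) hi)
    · exact off_f i hif
  simp only [extendOp_apply, eq_off_range_comp, ite_and]
  rfl

variable [Fintype ι] [Fintype V] [DecidableEq ι] [DecidableEq V]

/-- The extension `O ↦ O ⊗ I` as a homomorphism of star algebras. -/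
noncomputable def extendHom (hf : f.Injective) :
    Matrix (ι → Bool) (ι → Bool) ℂ →⋆ₐ[ℂ] Matrix (V → Bool) (V → Bool) ℂ where
  toFun := extendOp f
  map_one' := extendOp_one
  map_mul' := extendOp_mul hf
  map_zero' := by ext x y; simp [extendOp_apply]
  map_add' O O' := by ext x y; simp only [extendOp_apply, Matrix.add_apply]; split_ifs <;> simp
  commutes' c := by
    simp only [Matrix.algebraMap_eq_diagonal, extendOp_diagonal]
    rfl
  map_star' := extendOp_conjTranspose

theorem extendHom_apply (hf : f.Injective) (O : Matrix (ι → Bool) (ι → Bool) ℂ) :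
    extendHom hf O = extendOp f O :=
  rfl

theorem norm_extendOp_le (hf : f.Injective) (O : Matrix (ι → Bool) (ι → Bool) ℂ) :
    ‖extendOp f O‖ ≤ ‖O‖ :=
  NonUnitalStarAlgHom.norm_apply_le (extendHom hf) O

end ExtendOp

section AnnealingTerms

theorem involutive_flip {V : Type*} [DecidableEq V] (i : V) :
    Function.Involutive fun x : V → Bool => Function.update x i (!x i) := fun x => by simp

variable {ι V : Type*} [Fintype ι] [Fintype V]

/-- The cost `v` of the bit at the vertex `i`, as an operator. -/
noncomputable def siteCost (v : Bool → ℝ) (i : V) : Matrix (V → Bool) (V → Bool) ℂ :=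
  Matrix.diagonal fun x => (v (x i) : ℂ)

/-- The cost `u` of the bits at the vertices `i` and `j`, as an operator. -/
noncomputable def edgeCost (u : Bool → Bool → ℝ) (i j : V) : Matrix (V → Bool) (V → Bool) ℂ :=
  Matrix.diagonal fun x => (u (x i) (x j) : ℂ)

/-- The projection onto the basis states whose bit `i` is one. -/
noncomputable def occupation (i : V) : Matrix (V → Bool) (V → Bool) ℂ :=
  siteCost (fun b => if b then 1 else 0) i

theorem siteCost_eq (v : Bool → ℝ) (i : V) :
    siteCost v i = v false • (1 : Matrix (V → Bool) (V → Bool) ℂ) +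
      (v true - v false) • occupation i := by
  ext x y
  by_cases h : x = y
  · subst h
    cases hx : x i <;> simp [siteCost, occupation, hx]
  · simp [siteCost, occupation, h]

theorem extendOp_siteCost (f : ι → V) (v : Bool → ℝ) (i : ι) :
    extendOp f (siteCost v i) = siteCost v (f i) :=
  extendOp_diagonal _

theorem extendOp_edgeCost (f : ι → V) (u : Bool → Bool → ℝ) (i j : ι) :
    extendOp f (edgeCost u i j) = edgeCost u (f i) (f j) :=
  extendOp_diagonal _

variable [LinearOrder ι] [LinearOrder V]

theorem edgeCost_eq (u : Bool → Bool → ℝ) (i j : V) :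
    edgeCost u i j = siteCost (fun b => u b false) i +
      siteCost (fun b => u b true - u b false) i * occupation j := by
  ext x y
  by_cases h : x = y
  · subst h
    cases hx : x j <;> simp [siteCost, edgeCost, occupation, hx]
  · simp [siteCost, edgeCost, occupation, h]

theorem norm_occupation_le (i : V) : ‖occupation i‖ ≤ 1 := by
  rw [occupation, siteCost, Matrix.l2_opNorm_diagonal, pi_norm_le_iff_of_nonneg zero_le_one]
  intro x
  cases x i <;> simp

theorem bitFlip_apply (i : V) (x y : V → Bool) :
    bitFlip i x y = if x = Function.update y i (!y i) then 1 else 0 :=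
  rfl

theorem bitFlip_eq_permMatrix (i : V) :
    bitFlip i = (involutive_flip i).toPerm.permMatrix ℂ := by
  ext x y
  rw [bitFlip_apply, Equiv.Perm.permMatrix, PEquiv.toMatrix_toPEquiv_apply, Pi.single_apply]
  exact if_congr ((involutive_flip i).eq_iff.symm.trans eq_comm) rfl rfl

theorem isSelfAdjoint_bitFlip (i : V) : IsSelfAdjoint (bitFlip i) := by
  rw [IsSelfAdjoint, Matrix.star_eq_conjTranspose, bitFlip_eq_permMatrix,
    Matrix.conjTranspose_permMatrix]
  rfl

theorem norm_bitFlip_le (i : V) : ‖bitFlip i‖ ≤ 1 := by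
  rw [bitFlip_eq_permMatrix]
  exact Matrix.permMatrix_l2_opNorm_le _

theorem extendOp_bitFlip {f : ι → V} (hf : f.Injective) (i : ι) :
    extendOp f (bitFlip i) = bitFlip (f i) := by
  ext x y
  have update_comp : Function.update y (f i) (!y (f i)) ∘ f =
      Function.update (y ∘ f) i (!(y ∘ f) i) := Function.update_comp_eq_of_injective _ hf _ _
  have eq_update_iff : x = Function.update y (f i) (!y (f i)) ↔
      (∀ j ∉ Set.range f, x j = y j) ∧ x ∘ f = Function.update (y ∘ f) i (!(y ∘ f) i) := by
    rw [eq_iff_eq_off_range_and_comp_eq (f := f), update_comp]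
    refine and_congr_left' (forall₂_congr fun j hj => ?_)
    rw [Function.update_of_ne fun h => hj ⟨i, h.symm⟩]
  simp only [extendOp_apply, bitFlip_apply, eq_update_iff, ite_and]
  split_ifs <;> rfl

/-- The bit flip and the occupation number, which generate the operators on the qubit `i`. -/
noncomputable def generator (i : V) (b : Bool) : Matrix (V → Bool) (V → Bool) ℂ :=
  if b then bitFlip i else occupation i

theorem extendOp_generator {f : ι → V} (hf : f.Injective) (i : ι) (b : Bool) :
    extendOp f (generator i b) = generator (f i) b := by
  cases b
  exacts [extendOp_siteCost f (fun b => if b then 1 else 0) i, extendOp_bitFlip hf i]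

theorem commute_extendOp_generator {κ : Type*} {f : κ → V} {w : V} (hw : w ∉ Set.range f)
    (O : Matrix (κ → Bool) (κ → Bool) ℂ) (b : Bool) : Commute (extendOp f O) (generator w b) := by
  rw [← extendOp_generator (f := fun _ : Unit => w) (fun _ _ _ => rfl) () b]
  refine commute_extendOp_extendOp (Set.disjoint_right.2 ?_) _ _
  rintro _ ⟨-, rfl⟩
  exact hw

theorem commute_generator_generator {i w : V} (h : w ≠ i) (b c : Bool) :
    Commute (generator i b) (generator w c) := by
  rw [← extendOp_generator (f := fun _ : Unit => i) (fun _ _ _ => rfl) () b]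
  exact commute_extendOp_generator (by simpa using h) _ c

theorem norm_generator_le (i : V) (b : Bool) : ‖generator i b‖ ≤ 1 := by
  cases b
  exacts [norm_occupation_le i, norm_bitFlip_le i]

theorem isLocalTerm_generator_self (i : V) (b : Bool) :
    IsLocalTerm generator 1 {i} (generator i b) :=
  isLocalTerm_generator (norm_generator_le i b) fun _ hw c => commute_generator_generator hw b c

theorem isLocalTerm_siteCost {v : Bool → ℝ} {J : ℝ} (hv : ∀ b, |v b| ≤ J) (i : V) :
    IsLocalTerm generator (3 * J) {i} (siteCost v i) := by
  rw [siteCost_eq]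
  refine (((isLocalTerm_one generator {i}).smul (v false)).add
    ((isLocalTerm_generator_self i false).smul (v true - v false))).mono ?_ subset_rfl
  rw [Real.norm_eq_abs, Real.norm_eq_abs]
  linarith [abs_sub (v true) (v false), hv true, hv false]

theorem isLocalTerm_edgeCost {u : Bool → Bool → ℝ} {J : ℝ} (hu : ∀ b c, |u b c| ≤ J) {i j : V}
    (hij : i ≠ j) : IsLocalTerm generator (9 * J) {i, j} (edgeCost u i j) := by
  have diff_le (b : Bool) : |u b true - u b false| ≤ 2 * J := by
    linarith [abs_sub (u b true) (u b false), hu b true, hu b false]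
  rw [edgeCost_eq]
  refine (((isLocalTerm_siteCost (hu · false) i).mono le_rfl (by simp)).add
    ((isLocalTerm_siteCost diff_le i).mul (isLocalTerm_generator_self j false)
      (Finset.disjoint_singleton.2 hij))).mono (by linarith) subset_rfl

end AnnealingTerms

section Hamiltonian

/-- The vertices on which a term of the Hamiltonian acts. The terms are indexed by the vertices and
by the pairs of vertices, of which only those are used that are edges `⟨i, j⟩` with `i < j`. -/
def support {V : Type*} [DecidableEq V] : V ⊕ V × V → Finset V
  | .inl i => {i}
  | .inr (i, j) => {i, j}

theorem card_support_le {V : Type*} [DecidableEq V] (k : V ⊕ V × V) : (support k).card ≤ 2 := by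
  rcases k with i | ⟨i, j⟩
  exacts [(Finset.card_singleton i).trans_le one_le_two, Finset.card_le_two]

variable {ι V : Type*} [Fintype ι] [LinearOrder ι] [Fintype V] [LinearOrder V]

/-- The terms of `(1 - c) H₀ + c H₁`. -/
noncomputable def localTerm (v : Bool → ℝ) (u : Bool → Bool → ℝ) (c : ℝ) :
    V ⊕ V × V → Matrix (V → Bool) (V → Bool) ℂ
  | .inl i => (c - 1) • bitFlip i + (-c) • siteCost v i
  | .inr (i, j) => (-c) • edgeCost u i j

theorem extendOp_localTerm {f : ι → V} (hf : f.Injective) (v : Bool → ℝ) (u : Bool → Bool → ℝ)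
    (c : ℝ) (k : ι ⊕ ι × ι) :
    extendOp f (localTerm v u c k) = localTerm v u c (k.map f (Prod.map f f)) := by
  have extendOp_smul (a : ℝ) (O : Matrix (ι → Bool) (ι → Bool) ℂ) :
      extendOp f (a • O) = a • extendOp f O := by
    simpa only [Complex.coe_smul, extendHom_apply] using map_smul (extendHom hf) (a : ℂ) O
  rcases k with i | ⟨i, j⟩
  · calc extendOp f ((c - 1) • bitFlip i + (-c) • siteCost v i)
        = extendOp f ((c - 1) • bitFlip i) + extendOp f ((-c) • siteCost v i) :=
          map_add (extendHom hf) _ _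
      _ = (c - 1) • bitFlip (f i) + (-c) • siteCost v (f i) := by
          rw [extendOp_smul, extendOp_smul, extendOp_bitFlip hf, extendOp_siteCost]
  · exact (extendOp_smul _ _).trans (by rw [extendOp_edgeCost]; rfl)

open Classical in
/-- The terms of the Hamiltonian that belong to the vertices and edges of the subgraph `Y`. -/
noncomputable def localTerms {G : SimpleGraph V} (Y : G.Subgraph) : Finset (V ⊕ V × V) :=
  Finset.disjSum {i | i ∈ Y.verts} {e | e.1 < e.2 ∧ Y.Adj e.1 e.2}

variable {G : SimpleGraph V} {Y : G.Subgraph}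

theorem inl_mem_localTerms {i : V} : .inl i ∈ localTerms Y ↔ i ∈ Y.verts := by
  simp [localTerms]

theorem inr_mem_localTerms {i j : V} : .inr (i, j) ∈ localTerms Y ↔ i < j ∧ Y.Adj i j := by
  simp [localTerms]

theorem localTerms_mono {Z : G.Subgraph} (h : Y ≤ Z) : localTerms Y ⊆ localTerms Z := by
  rintro (i | ⟨i, j⟩) hk
  · exact inl_mem_localTerms.2 (h.1 (inl_mem_localTerms.1 hk))
  · exact inr_mem_localTerms.2 ((inr_mem_localTerms.1 hk).imp_right fun hY => h.2 hY)

theorem card_localTerms_filter_le [DecidableRel G.Adj] {d : ℕ} (hG : ∀ w, G.degree w ≤ d)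
    (Y : G.Subgraph) (w : V) : {k ∈ localTerms Y | w ∈ support k}.card ≤ d + 1 := by
  let incident := (G.neighborFinset w).image fun j => (Sum.inr (min w j, max w j) : V ⊕ V × V)
  have subset_insert : {k ∈ localTerms Y | w ∈ support k} ⊆ insert (.inl w) incident := by
    rintro (i | ⟨i, j⟩) hk <;> obtain ⟨hk, hw⟩ := Finset.mem_filter.1 hk
    · rw [Finset.mem_singleton.1 hw]
      exact Finset.mem_insert_self _ _
    · obtain ⟨hij, hadj⟩ := inr_mem_localTerms.1 hk
      refine Finset.mem_insert_of_mem (Finset.mem_image.2 ?_)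
      obtain rfl | hwj := Finset.mem_insert.1 hw
      · exact ⟨j, by simpa using hadj.adj_sub, by rw [min_eq_left hij.le, max_eq_right hij.le]⟩
      · obtain rfl := Finset.mem_singleton.1 hwj
        exact ⟨i, by simpa using hadj.adj_sub.symm,
          by rw [min_eq_right hij.le, max_eq_left hij.le]⟩
  calc _ ≤ (insert (Sum.inl w) incident).card := Finset.card_le_card subset_insert
    _ ≤ incident.card + 1 := Finset.card_insert_le _ _
    _ ≤ d + 1 := by
      gcongr
      exact Finset.card_image_le.trans (hG w)

theorem isLocalTerm_localTerm {v : Bool → ℝ} {u : Bool → Bool → ℝ} {J c : ℝ}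
    (hv : ∀ b, |v b| ≤ J) (hu : ∀ b c, |u b c| ≤ J) (hc : c ∈ Set.Icc 0 1) {k : V ⊕ V × V}
    (hk : k ∈ localTerms Y) :
    IsLocalTerm generator (1 + 9 * J) (support k) (localTerm v u c k) := by
  have hJ : 0 ≤ J := (abs_nonneg _).trans (hv false)
  have norm_sub_one : ‖c - 1‖ = 1 - c := by
    rw [Real.norm_eq_abs, abs_of_nonpos (by linarith [hc.2]), neg_sub]
  have norm_neg : ‖-c‖ = c := by rw [norm_neg, Real.norm_of_nonneg hc.1]
  rcases k with i | ⟨i, j⟩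
  · refine (((isLocalTerm_generator_self i true).smul (c - 1)).add
      ((isLocalTerm_siteCost hv i).smul (-c))).mono ?_ subset_rfl
    rw [norm_sub_one, norm_neg]
    nlinarith [hc.1, hc.2]
  · refine ((isLocalTerm_edgeCost hu (inr_mem_localTerms.1 hk).1.ne).smul (-c)).mono ?_ subset_rfl
    rw [norm_neg]
    nlinarith [hc.1, hc.2]

theorem isLocalFamily_localTerm [DecidableRel G.Adj] {d : ℕ} (hG : ∀ w, G.degree w ≤ d)
    (Y : G.Subgraph) {v : Bool → ℝ} {u : Bool → Bool → ℝ} {J c : ℝ} (hv : ∀ b, |v b| ≤ J)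
    (hu : ∀ b c, |u b c| ≤ J) (hc : c ∈ Set.Icc 0 1) :
    IsLocalFamily generator (1 + 9 * J) 2 (d + 1) (localTerms Y) support (localTerm v u c) where
  norm_generator_le := norm_generator_le
  isLocalTerm _ hk := isLocalTerm_localTerm hv hu hc hk
  card_support_le k _ := card_support_le k
  card_terms_le := card_localTerms_filter_le hG Y

open Classical in
theorem targetHamiltonian_eq_sum (v : Bool → ℝ) (u : Bool → Bool → ℝ) (G : SimpleGraph V) :
    targetHamiltonian v u G =
      -(∑ i, siteCost v i + ∑ e : V × V with e.1 < e.2 ∧ G.Adj e.1 e.2, edgeCost u e.1 e.2) := by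
  have cost_eq (x : V → Bool) : cost v u G x =
      ∑ i, v (x i) + ∑ e : V × V with e.1 < e.2 ∧ G.Adj e.1 e.2, u (x e.1) (x e.2) := by
    simp only [cost, Finset.sum_filter, Fintype.sum_prod_type]
  ext x y
  by_cases h : x = y
  · subst h
    simp [targetHamiltonian, cost_eq, siteCost, edgeCost, Matrix.sum_apply]
  · simp [targetHamiltonian, siteCost, edgeCost, Matrix.sum_apply, h]

theorem hamiltonian_eq_sum (v : Bool → ℝ) (u : Bool → Bool → ℝ) (G : SimpleGraph V) (T t : ℝ) :
    hamiltonian v u G T t = ∑ k ∈ localTerms (⊤ : G.Subgraph), localTerm v u (t / T) k := by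
  classical
  simp only [localTerms, Finset.sum_disjSum, localTerm, SimpleGraph.Subgraph.verts_top,
    SimpleGraph.Subgraph.top_adj, Set.mem_univ, Finset.filter_true, Finset.sum_add_distrib,
    ← Finset.smul_sum, hamiltonian, initialHamiltonian, targetHamiltonian_eq_sum]
  module

theorem map_localTerms_top (Y : G.Subgraph) :
    (localTerms (⊤ : Y.coe.Subgraph)).map
      ((Function.Embedding.subtype (· ∈ Y.verts)).sumMap
        ((Function.Embedding.subtype (· ∈ Y.verts)).prodMap (.subtype (· ∈ Y.verts)))) =
      localTerms Y := by
  ext (i | ⟨i, j⟩)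
  · simp [inl_mem_localTerms]
  · simp only [Finset.mem_map, Sum.exists, Prod.exists, inr_mem_localTerms]
    simpa using show _ ↔ i < j ∧ Y.Adj i j from
      ⟨fun h => ⟨h.1.1.2, h.1.2⟩, fun h => ⟨⟨⟨Y.edge_vert h.2.symm, h.1⟩, h.2⟩, Y.edge_vert h.2⟩⟩

theorem extendOp_hamiltonian_coe (v : Bool → ℝ) (u : Bool → Bool → ℝ) (Y : G.Subgraph) (T t : ℝ) :
    extendOp Subtype.val (hamiltonian v u Y.coe T t) =
      ∑ k ∈ localTerms Y, localTerm v u (t / T) k := by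
  have hf : Function.Injective (Subtype.val : Y.verts → V) := Subtype.val_injective
  rw [hamiltonian_eq_sum, ← extendHom_apply hf, map_sum, ← map_localTerms_top Y, Finset.sum_map]
  exact Finset.sum_congr rfl fun k _ => extendOp_localTerm hf v u (t / T) k

theorem isSelfAdjoint_hamiltonian (v : Bool → ℝ) (u : Bool → Bool → ℝ) (G : SimpleGraph V)
    (T t : ℝ) : IsSelfAdjoint (hamiltonian v u G T t) := by
  have initial : IsSelfAdjoint (initialHamiltonian V) :=
    (isSelfAdjoint_sum _ fun i _ => isSelfAdjoint_bitFlip i).neg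
  have target : IsSelfAdjoint (targetHamiltonian v u G) :=
    Matrix.isHermitian_diagonal_of_self_adjoint _ (funext fun x => by simp)
  exact (IsSelfAdjoint.smul (.all (1 - t / T)) initial).add (.smul (.all (t / T)) target)

theorem isSchrodinger_evolution (v : Bool → ℝ) (u : Bool → Bool → ℝ) (G : SimpleGraph V) (T : ℝ) :
    IsSchrodinger (hamiltonian v u G T) (evolution v u G T) where
  zero := (evolution_spec v u G T).1
  hasDerivAt := (evolution_spec v u G T).2
  isSelfAdjoint := isSelfAdjoint_hamiltonian v u G T
  mem_unitary t := Matrix.mem_unitaryGroup_iff'.2 <|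
    star_mul_self_eq_one_of_hasDerivAt (evolution_spec v u G T).1 (evolution_spec v u G T).2
      (isSelfAdjoint_hamiltonian v u G T) t

end Hamiltonian

section CappedDist

variable {V : Type*} {G : SimpleGraph V} {X : G.Subgraph} {r : ℕ} {w z : V}

/-- The distance from `X` to `w`, or `r` if that is smaller. -/
noncomputable def cappedDist (X : G.Subgraph) (r : ℕ) (w : V) : ℕ :=
  sInf {k | k = r ∨ ∃ a ∈ X.verts, ∃ p : G.Walk a w, p.length = k}

theorem cappedDist_eq_or_exists_walk (X : G.Subgraph) (r : ℕ) (w : V) :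
    cappedDist X r w = r ∨ ∃ a ∈ X.verts, ∃ p : G.Walk a w, p.length = cappedDist X r w :=
  Nat.sInf_mem (s := {k | k = r ∨ ∃ a ∈ X.verts, ∃ p : G.Walk a w, p.length = k}) ⟨r, .inl rfl⟩

theorem cappedDist_le (X : G.Subgraph) (r : ℕ) (w : V) : cappedDist X r w ≤ r :=
  Nat.sInf_le (.inl rfl)

theorem cappedDist_le_length (r : ℕ) {a : V} (ha : a ∈ X.verts) (p : G.Walk a w) :
    cappedDist X r w ≤ p.length :=
  Nat.sInf_le (.inr ⟨a, ha, p, rfl⟩)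

theorem cappedDist_eq_zero (r : ℕ) (hw : w ∈ X.verts) : cappedDist X r w = 0 :=
  Nat.le_zero.1 (cappedDist_le_length r hw .nil)

theorem cappedDist_le_add_one (X : G.Subgraph) (r : ℕ) (h : G.Adj w z) :
    cappedDist X r w ≤ cappedDist X r z + 1 := by
  obtain hz | ⟨a, ha, p, hp⟩ := cappedDist_eq_or_exists_walk X r z
  · exact (cappedDist_le X r w).trans (hz.ge.trans (Nat.le_succ _))
  · rw [← hp, ← p.length_concat h.symm]
    exact cappedDist_le_length r ha _

theorem exists_isPath_of_cappedDist_ne (h : cappedDist X r w ≠ r) :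
    ∃ a ∈ X.verts, ∃ p : G.Walk a w, p.IsPath ∧ p.length < r := by
  classical
  obtain ⟨a, ha, p, hp⟩ := (cappedDist_eq_or_exists_walk X r w).resolve_left h
  exact ⟨a, ha, p.bypass, p.bypass_isPath,
    p.length_bypass_le_length.trans_lt (hp ▸ (cappedDist_le X r w).lt_of_ne h)⟩

theorem cappedDist_eq_of_notMem_verts_ball (h : w ∉ (ball X r).verts) : cappedDist X r w = r := by
  by_contra hw
  obtain ⟨a, ha, p, hp, hlt⟩ := exists_isPath_of_cappedDist_ne hw
  exact h (.inr ⟨a, ha, w, p, hp, hlt.le, p.end_mem_support⟩)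

theorem cappedDist_eq_of_not_ball_adj (hwz : G.Adj w z) (h : ¬ (ball X r).Adj w z) :
    cappedDist X r w = r := by
  classical
  by_contra hw
  obtain ⟨a, ha, p, hp, hlt⟩ := exists_isPath_of_cappedDist_ne hw
  by_cases hz : z ∈ p.support
  · refine h (.inr ⟨a, ha, w, (p.takeUntil z hz).concat hwz.symm, ?_, ?_, ?_⟩)
    · exact (hp.takeUntil hz).concat
        (SimpleGraph.Walk.endpoint_notMem_support_takeUntil hp hz hwz.ne) hwz.symm
    · rw [SimpleGraph.Walk.length_concat]
      exact (Nat.succ_le_succ (p.length_takeUntil_le_length hz)).trans hlt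
    · simp [SimpleGraph.Walk.edges_concat, Sym2.eq_swap]
  · refine h (.inr ⟨a, ha, z, p.concat hwz, hp.concat hz hwz, ?_, ?_⟩)
    · rwa [SimpleGraph.Walk.length_concat]
    · simp [SimpleGraph.Walk.edges_concat]

variable [Fintype V] [LinearOrder V] {k : V ⊕ V × V}

theorem cappedDist_le_add_one_of_mem_support (X : G.Subgraph) (r : ℕ) {i j : V}
    (hk : k ∈ localTerms (⊤ : G.Subgraph)) (hi : i ∈ support k) (hj : j ∈ support k) :
    cappedDist X r i ≤ cappedDist X r j + 1 := by
  rcases k with w | ⟨w, z⟩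
  · rw [Finset.mem_singleton.1 hi, Finset.mem_singleton.1 hj]
    exact Nat.le_succ _
  · have hwz : G.Adj w z := (inr_mem_localTerms.1 hk).2
    simp only [support, Finset.mem_insert, Finset.mem_singleton] at hi hj
    obtain ⟨rfl | rfl, rfl | rfl⟩ := And.intro hi hj
    exacts [Nat.le_succ _, cappedDist_le_add_one X r hwz, cappedDist_le_add_one X r hwz.symm,
      Nat.le_succ _]

theorem cappedDist_eq_of_mem_support {i : V}
    (hk : k ∈ localTerms (⊤ : G.Subgraph) \ localTerms (ball X r)) (hi : i ∈ support k) :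
    cappedDist X r i = r := by
  obtain ⟨hk, hk_ball⟩ := Finset.mem_sdiff.1 hk
  rcases k with w | ⟨w, z⟩
  · rw [Finset.mem_singleton.1 hi]
    exact cappedDist_eq_of_notMem_verts_ball (mt inl_mem_localTerms.2 hk_ball)
  · obtain ⟨hlt, hwz⟩ := inr_mem_localTerms.1 hk
    have not_adj : ¬ (ball X r).Adj w z := fun h => hk_ball (inr_mem_localTerms.2 ⟨hlt, h⟩)
    simp only [support, Finset.mem_insert, Finset.mem_singleton] at hi
    obtain rfl | rfl := hi
    · exact cappedDist_eq_of_not_ball_adj hwz not_adj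
    · exact cappedDist_eq_of_not_ball_adj hwz.symm fun h => not_adj h.symm

end CappedDist

section Locality

variable {V : Type*} [Fintype V] [LinearOrder V]

theorem weightedOscillation_extendOp_le {ι : Type*} [Fintype ι] [DecidableEq ι] {f : ι → V}
    (hf : f.Injective) {q : V → ℝ} (hq : ∀ i, 0 ≤ q (f i)) (O : Matrix (ι → Bool) (ι → Bool) ℂ) :
    weightedOscillation generator q (extendOp f O) ≤ (∑ i, q (f i)) * (4 * ‖O‖) := by
  have oscillation_eq_zero (w : V) (hw : w ∉ Set.range f) :
      oscillation generator w (extendOp f O) = 0 :=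
    Finset.sum_eq_zero fun b _ => by
      rw [(commute_extendOp_generator hw O b).symm.lie_eq, norm_zero]
  have oscillation_le (w : V) : oscillation generator w (extendOp f O) ≤ 4 * ‖O‖ :=
    calc ∑ b, ‖⁅generator w b, extendOp f O⁆‖ ≤ ∑ _ : Bool, 2 * 1 * ‖O‖ := by
          gcongr with b
          refine (norm_lie_le _ _).trans ?_
          gcongr
          exacts [norm_generator_le w b, norm_extendOp_le hf O]
      _ = 4 * ‖O‖ := by
          rw [Fintype.sum_bool]
          ring
  calc weightedOscillation generator q (extendOp f O)
      = ∑ i, q (f i) * oscillation generator (f i) (extendOp f O) := by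
        refine (Fintype.sum_of_injective f hf _ _ (fun w hw => ?_) fun _ => rfl).symm
        rw [oscillation_eq_zero w hw, mul_zero]
    _ ≤ ∑ i, q (f i) * (4 * ‖O‖) := by
        gcongr with i
        exacts [hq i, oscillation_le (f i)]
    _ = (∑ i, q (f i)) * (4 * ‖O‖) := (Finset.sum_mul _ _ _).symm

theorem extendOp_heisenberg {ι : Type*} [Fintype ι] [LinearOrder ι] {f : ι → V}
    (hf : f.Injective) (v : Bool → ℝ) (u : Bool → Bool → ℝ) (G : SimpleGraph ι) (T : ℝ)
    (O : Matrix (ι → Bool) (ι → Bool) ℂ) :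
    extendOp f (heisenberg v u G T O) =
      star (extendOp f (evolution v u G T T)) * extendOp f O *
        extendOp f (evolution v u G T T) := by
  rw [heisenberg, extendOp_mul hf, extendOp_mul hf, extendOp_conjTranspose,
    Matrix.star_eq_conjTranspose]

variable {v : Bool → ℝ} {u : Bool → Bool → ℝ} {J : ℝ} {G : SimpleGraph V} [DecidableRel G.Adj]
  {d : ℕ} {T μ : ℝ}

theorem norm_heisenberg_sub_le (hv : ∀ b, |v b| ≤ J) (hu : ∀ b c, |u b c| ≤ J)
    (hG : ∀ w, G.degree w ≤ d) (X : G.Subgraph) (r : ℕ)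
    (O : Matrix (X.verts → Bool) (X.verts → Bool) ℂ) (hT : 0 < T) (hμ : 0 ≤ μ) :
    ‖heisenberg v u G T (extendOp Subtype.val O) -
        extendOp Subtype.val (heisenberg v u (ball X r).coe T
          (extendOp (Set.inclusion (verts_subset_ball X r)) O))‖ ≤
      (1 + 9 * J) * (d + 1 : ℕ) / Real.exp (μ * r) * (X.verts.ncard * (4 * ‖O‖) *
        Real.exp (growthRate (1 + 9 * J) 2 (d + 1) (Fintype.card Bool) (Real.exp μ) * T)) * T := by
  have hJ : 0 ≤ J := (abs_nonneg _).trans (hv false)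
  have hval : Function.Injective (Subtype.val : (ball X r).verts → V) := Subtype.val_injective
  let q : V → ℝ := fun w => Real.exp (μ * cappedDist X r w)
  have hU : IsSchrodinger (fun t => ∑ k ∈ localTerms (⊤ : G.Subgraph), localTerm v u (t / T) k)
      (evolution v u G T) := by
    simpa only [← hamiltonian_eq_sum] using isSchrodinger_evolution v u G T
  have hW : IsSchrodinger (fun t => ∑ k ∈ localTerms (ball X r), localTerm v u (t / T) k)
      fun t => extendOp Subtype.val (evolution v u (ball X r).coe T t) := by
    simp only [← extendOp_hamiltonian_coe]
    exact (isSchrodinger_evolution v u (ball X r).coe T).map (extendHom hval)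
  have oscillation_le : weightedOscillation generator q (extendOp Subtype.val O) ≤
      X.verts.ncard * (4 * ‖O‖) := by
    have q_eq_one (w : X.verts) : q w = 1 := by simp [q, cappedDist_eq_zero r w.2]
    simpa only [q_eq_one, Finset.sum_const, Finset.card_univ, nsmul_one, ← Nat.card_eq_fintype_card,
      Nat.card_coe_set_eq] using
      weightedOscillation_extendOp_le (q := q) Subtype.val_injective (fun w => (Real.exp_pos _).le)
        O
  rw [extendOp_heisenberg hval, extendOp_extendOp hval, heisenberg]
  refine (hU.norm_conj_sub_conj_le_of_isLocalFamily (q := q) (l := Real.exp μ) hW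
    (localTerms_mono le_top) hT.le
    (fun t ht => isLocalFamily_localTerm hG ⊤ hv hu
      ⟨div_nonneg ht.1 hT.le, div_le_one_of_le₀ ht.2 hT.le⟩)
    (by positivity) (fun w => (Real.exp_pos _).le) (Real.exp_pos μ).le (fun k hk i hi j hj => ?_)
    (Real.exp_pos (μ * r)) (fun k hk i hi => ?_) _).trans ?_
  · rw [← Real.exp_add]
    have : (cappedDist X r i : ℝ) ≤ cappedDist X r j + 1 := by
      exact_mod_cast cappedDist_le_add_one_of_mem_support X r hk hi hj
    refine Real.exp_le_exp.2 ?_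
    nlinarith
  · simp only [q, cappedDist_eq_of_mem_support hk hi, le_refl]
  · gcongr

/-- A Lieb–Robinson velocity for annealing with costs at most `J` on a graph of degree at most `d`:
outside the light cone it defines, influences are damped at the exponential rate `μ`. -/
noncomputable def liebRobinsonVelocity (J : ℝ) (d : ℕ) (μ : ℝ) : ℝ :=
  growthRate (1 + 9 * J) 2 (d + 1) (Fintype.card Bool) (Real.exp (μ + 1)) + 1

theorem liebRobinsonVelocity_pos (hJ : 0 ≤ J) (d : ℕ) (μ : ℝ) : 0 < liebRobinsonVelocity J d μ :=
  add_pos_of_nonneg_of_pos (growthRate_nonneg (by positivity) (Real.exp_pos _).le _ _ _) one_pos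

theorem norm_heisenberg_sub_le_of_velocity_mul_le (hv : ∀ b, |v b| ≤ J) (hu : ∀ b c, |u b c| ≤ J)
    (hG : ∀ w, G.degree w ≤ d) {X : G.Subgraph} {m : ℕ} (hX : X.verts.ncard ≤ m)
    (O : Matrix (X.verts → Bool) (X.verts → Bool) ℂ) (hT : 0 < T) (hμ : 0 ≤ μ) {r : ℕ}
    (hr : liebRobinsonVelocity J d μ * T ≤ r) :
    ‖heisenberg v u G T (extendOp Subtype.val O) -
        extendOp Subtype.val (heisenberg v u (ball X r).coe T
          (extendOp (Set.inclusion (verts_subset_ball X r)) O))‖ ≤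
      4 * (1 + 9 * J) * (d + 1) * m * ‖O‖ * Real.exp (-μ * r) := by
  have hJ : 0 ≤ J := (abs_nonneg _).trans (hv false)
  let κ := growthRate (1 + 9 * J) 2 (d + 1) (Fintype.card Bool) (Real.exp (μ + 1))
  have hκ : (κ + 1) * T ≤ r := hr
  have exp_le : Real.exp (κ * T) * T / Real.exp ((μ + 1) * r) ≤ Real.exp (-μ * r) :=
    calc Real.exp (κ * T) * T / Real.exp ((μ + 1) * r)
        ≤ Real.exp (κ * T) * Real.exp T / Real.exp ((μ + 1) * r) := by
          gcongr
          linarith [Real.add_one_le_exp T]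
      _ = Real.exp (κ * T + T - (μ + 1) * r) := by rw [Real.exp_sub, Real.exp_add]
      _ ≤ Real.exp (-μ * r) := Real.exp_le_exp.2 (by linarith)
  calc _ ≤ (1 + 9 * J) * (d + 1 : ℕ) / Real.exp ((μ + 1) * r) *
        (X.verts.ncard * (4 * ‖O‖) * Real.exp (κ * T)) * T :=
        norm_heisenberg_sub_le hv hu hG X r O hT (by positivity)
    _ = 4 * (1 + 9 * J) * (d + 1) * X.verts.ncard * ‖O‖ *
        (Real.exp (κ * T) * T / Real.exp ((μ + 1) * r)) := by
      push_cast
      ring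
    _ ≤ _ := by gcongr

theorem exists_abs_le (v : Bool → ℝ) (u : Bool → Bool → ℝ) :
    ∃ J, (∀ b, |v b| ≤ J) ∧ ∀ b c, |u b c| ≤ J := by
  obtain ⟨J₁, hv⟩ := Finite.exists_le fun b => |v b|
  obtain ⟨J₂, hu⟩ := Finite.exists_le fun b : Bool × Bool => |u b.1 b.2|
  exact ⟨max J₁ J₂, fun b => (hv b).trans (le_max_left _ _),
    fun b c => (hu (b, c)).trans (le_max_right _ _)⟩

end Locality

section ExpectedValue

theorem norm_star_dotProduct_mulVec_le {n : Type*} [Fintype n] [DecidableEq n]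
    (M : Matrix n n ℂ) (x : n → ℂ) : ‖star x ⬝ᵥ M.mulVec x‖ ≤ ‖M‖ * ‖WithLp.toLp 2 x‖ ^ 2 := by
  let y : EuclideanSpace ℂ n := WithLp.toLp 2 x
  let My : EuclideanSpace ℂ n := WithLp.toLp 2 (M.mulVec x)
  calc ‖star x ⬝ᵥ M.mulVec x‖ = ‖inner ℂ y My‖ := by
        rw [EuclideanSpace.inner_toLp_toLp, dotProduct_comm]
    _ ≤ ‖y‖ * ‖My‖ := norm_inner_le_norm y My
    _ ≤ ‖y‖ * (‖M‖ * ‖y‖) := by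
        gcongr
        exact Matrix.l2_opNorm_mulVec M y
    _ = ‖M‖ * ‖y‖ ^ 2 := by ring

variable {V : Type*} [Fintype V] [DecidableEq V]

theorem norm_uniformState (V : Type*) [Fintype V] [DecidableEq V] :
    ‖WithLp.toLp 2 (uniformState V)‖ = 1 := by
  have sqrt_two_pow (n : ℕ) : |√2| ^ (n * 2) = 2 ^ n := by
    rw [mul_comm, pow_mul, sq_abs, Real.sq_sqrt zero_le_two]
  simp [EuclideanSpace.norm_eq, uniformState, ← pow_mul, sqrt_two_pow]

theorem star_uniformState_dotProduct_mulVec (M : Matrix (V → Bool) (V → Bool) ℂ) :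
    star (uniformState V) ⬝ᵥ M.mulVec (uniformState V) =
      (Fintype.card (V → Bool) : ℂ)⁻¹ * ∑ x, ∑ y, M x y := by
  have star_mul_self :
      star (((√2 : ℝ) : ℂ)⁻¹ ^ Fintype.card V) * ((√2 : ℝ) : ℂ)⁻¹ ^ Fintype.card V =
        (Fintype.card (V → Bool) : ℂ)⁻¹ := by
    rw [star_pow, ← mul_pow]
    simp [← mul_inv, ← Complex.ofReal_mul]
  simp only [dotProduct, Matrix.mulVec, uniformState, Pi.star_apply, ← Finset.sum_mul,
    ← Finset.mul_sum, ← star_mul_self]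
  ring

variable {ι : Type*} [Fintype ι] [DecidableEq ι] {f : ι → V}

theorem card_mul_sum_comp (hf : f.Injective) (F : (ι → Bool) → ℂ) :
    (Fintype.card (ι → Bool) : ℂ) * ∑ x : V → Bool, F (x ∘ f) =
      (Fintype.card (V → Bool) : ℂ) * ∑ w, F w := by
  -- Both sides are the sum of `F (y ∘ f)` over all `x` and `y` that agree off the range of `f`.
  let E : Matrix (V → Bool) (V → Bool) ℂ := extendOp f (Matrix.of fun _ _ => 1)
  have E_comm (x y : V → Bool) : E x y = E y x := by
    simp only [E, extendOp_apply, Matrix.of_apply, eq_comm (a := x _)]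
    congr
  have sum_E_mul (x : V → Bool) (F : (ι → Bool) → ℂ) : ∑ y, E x y * F (y ∘ f) = ∑ w, F w := by
    simp [E, sum_extendOp_mul hf _ x fun y => F (y ∘ f), Function.extend_comp hf]
  calc (Fintype.card (ι → Bool) : ℂ) * ∑ x : V → Bool, F (x ∘ f)
      = ∑ y : V → Bool, ∑ x, E x y * F (y ∘ f) := by
        have sum_E (y : V → Bool) : ∑ x, E x y = Fintype.card (ι → Bool) := by
          simpa [E_comm _ y] using sum_E_mul y fun _ => 1
        simp only [← Finset.sum_mul, sum_E, Finset.mul_sum]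
    _ = ∑ x : V → Bool, ∑ y, E x y * F (y ∘ f) := Finset.sum_comm
    _ = (Fintype.card (V → Bool) : ℂ) * ∑ w, F w := by
        simp only [sum_E_mul, Finset.sum_const, Finset.card_univ, nsmul_eq_mul]

theorem star_uniformState_dotProduct_extendOp_mulVec (hf : f.Injective)
    (M : Matrix (ι → Bool) (ι → Bool) ℂ) :
    star (uniformState V) ⬝ᵥ (extendOp f M).mulVec (uniformState V) =
      star (uniformState ι) ⬝ᵥ M.mulVec (uniformState ι) := by
  have sum_extendOp (x : V → Bool) : ∑ y, extendOp f M x y = ∑ w, M (x ∘ f) w := by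
    simpa using sum_extendOp_mul hf M x fun _ => 1
  rw [star_uniformState_dotProduct_mulVec, star_uniformState_dotProduct_mulVec,
    Finset.sum_congr rfl fun x _ => sum_extendOp x, inv_mul_eq_iff_eq_mul₀ (by simp),
    mul_left_comm, eq_inv_mul_iff_mul_eq₀ (by simp), card_mul_sum_comp hf fun z => ∑ w, M z w]

theorem expectedValue_eq {V : Type*} [Fintype V] [LinearOrder V] (v : Bool → ℝ)
    (u : Bool → Bool → ℝ) (G : SimpleGraph V) (T : ℝ) (A : Matrix (V → Bool) (V → Bool) ℂ) :
    expectedValue v u G T A =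
      star (uniformState V) ⬝ᵥ (heisenberg v u G T A).mulVec (uniformState V) := by
  rw [expectedValue, finalState, heisenberg, Matrix.star_mulVec, ← Matrix.dotProduct_mulVec,
    Matrix.mulVec_mulVec, Matrix.mulVec_mulVec, Matrix.mul_assoc]

theorem norm_expectedValue_sub_le {ι V : Type*} [Fintype ι] [LinearOrder ι] [Fintype V]
    [LinearOrder V] {f : ι → V} (hf : f.Injective) (v : Bool → ℝ) (u : Bool → Bool → ℝ)
    (G : SimpleGraph V) (G' : SimpleGraph ι) (T : ℝ) (A : Matrix (V → Bool) (V → Bool) ℂ)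
    (A' : Matrix (ι → Bool) (ι → Bool) ℂ) :
    ‖expectedValue v u G T A - expectedValue v u G' T A'‖ ≤
      ‖heisenberg v u G T A - extendOp f (heisenberg v u G' T A')‖ := by
  rw [expectedValue_eq, expectedValue_eq, ← star_uniformState_dotProduct_extendOp_mulVec hf,
    ← dotProduct_sub, ← Matrix.sub_mulVec]
  simpa [norm_uniformState] using norm_star_dotProduct_mulVec_le _ (uniformState V)

end ExpectedValue

end QuantumAnnealing

open Filter Topology QuantumAnnealing in
theorem mainTheorem4_general (v : Bool → ℝ) (u : Bool → Bool → ℝ) (d m : ℕ) :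
    (∀ ε : ℝ, 0 < ε → ∀ T : ℝ, 0 < T → ∀ K : ℝ, ∃ r₀ : ℕ, ∀ r : ℕ, r₀ ≤ r →
      ∀ (V : Type*) [Fintype V] [LinearOrder V] (G : SimpleGraph V) [DecidableRel G.Adj],
        (∀ w, G.degree w ≤ d) →
      ∀ X : G.Subgraph, X.verts.ncard ≤ m →
      ∀ O : Matrix (X.verts → Bool) (X.verts → Bool) ℂ, ‖O‖ ≤ K →
        ‖expectedValue v u G T (extendOp Subtype.val O) -
          expectedValue v u (ball X r).coe T
            (extendOp (Set.inclusion (verts_subset_ball X r)) O)‖ ≤ ε) ∧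
    (∀ μ : ℝ, 0 ≤ μ → ∃ vLR C : ℝ, 0 < vLR ∧ 0 < C ∧
      ∀ (V : Type*) [Fintype V] [LinearOrder V] (G : SimpleGraph V) [DecidableRel G.Adj],
        (∀ w, G.degree w ≤ d) →
      ∀ X : G.Subgraph, X.verts.ncard ≤ m →
      ∀ O : Matrix (X.verts → Bool) (X.verts → Bool) ℂ,
      ∀ T : ℝ, 0 < T → ∀ r : ℕ, vLR * T ≤ r →
        ‖heisenberg v u G T (extendOp Subtype.val O) -
          extendOp Subtype.val (heisenberg v u (ball X r).coe T
            (extendOp (Set.inclusion (verts_subset_ball X r)) O))‖ ≤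
          C * ‖O‖ * Real.exp (-μ * r)) := by
  obtain ⟨J, hv, hu⟩ := exists_abs_le v u
  have hJ : 0 ≤ J := (abs_nonneg _).trans (hv false)
  let C : ℝ := 4 * (1 + 9 * J) * (d + 1) * m
  refine ⟨fun ε hε T hT K => ?_, fun μ hμ => ⟨liebRobinsonVelocity J d μ, C + 1,
    liebRobinsonVelocity_pos hJ d μ, by positivity,
    fun V _ _ G _ hG X hX O T hT r hr => ?_⟩⟩
  · have bound_tendsto : Tendsto (fun r : ℕ => C * |K| * Real.exp (-1 * r)) atTop (𝓝 0) := by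
      have natCast_tendsto : Tendsto (fun r : ℕ => (r : ℝ)) atTop atTop :=
        tendsto_natCast_atTop_atTop
      simpa using (Real.tendsto_exp_neg_atTop_nhds_zero.comp natCast_tendsto).const_mul (C * |K|)
    obtain ⟨r₀, hr₀⟩ := eventually_atTop.1 ((bound_tendsto.eventually_le_const hε).and
      (tendsto_natCast_atTop_atTop.eventually_ge_atTop (liebRobinsonVelocity J d 1 * T)))
    refine ⟨r₀, fun r hr V _ _ G _ hG X hX O hO => ?_⟩
    calc _ ≤ _ := norm_expectedValue_sub_le Subtype.val_injective v u G _ T _ _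
      _ ≤ C * ‖O‖ * Real.exp (-1 * r) :=
        norm_heisenberg_sub_le_of_velocity_mul_le hv hu hG hX O hT zero_le_one (hr₀ r hr).2
      _ ≤ C * |K| * Real.exp (-1 * r) := by
        gcongr
        exact hO.trans (le_abs_self K)
      _ ≤ ε := (hr₀ r hr).1
  · refine (norm_heisenberg_sub_le_of_velocity_mul_le hv hu hG hX O hT hμ hr).trans ?_
    gcongr
    exact (lt_add_one C).le

theorem mainTheorem4 (v : Bool → ℝ) (u : Bool → Bool → ℝ) (d m : ℕ) :
    (∀ ε : ℝ, 0 < ε → ∀ T : ℝ, 0 < T → ∀ K : ℝ, ∃ r₀ : ℕ, ∀ r : ℕ, r₀ ≤ r →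
      ∀ (V : Type*) [Fintype V] [LinearOrder V] (G : SimpleGraph V) [DecidableRel G.Adj],
        (∀ w, G.degree w ≤ d) →
      ∀ X : G.Subgraph, X.verts.ncard ≤ m →
      ∀ O : Matrix (X.verts → Bool) (X.verts → Bool) ℂ, O.IsHermitian → ‖O‖ ≤ K →
        ‖QuantumAnnealing.expectedValue v u G T (QuantumAnnealing.extendOp Subtype.val O) -
          QuantumAnnealing.expectedValue v u (QuantumAnnealing.ball X r).coe T
            (QuantumAnnealing.extendOp
              (Set.inclusion (QuantumAnnealing.verts_subset_ball X r)) O)‖ ≤ ε) ∧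
    (∃ vLR μ C : ℝ, 0 < vLR ∧ 0 < μ ∧ 0 < C ∧
      ∀ (V : Type*) [Fintype V] [LinearOrder V] (G : SimpleGraph V) [DecidableRel G.Adj],
        (∀ w, G.degree w ≤ d) →
      ∀ X : G.Subgraph, X.verts.ncard ≤ m →
      ∀ O : Matrix (X.verts → Bool) (X.verts → Bool) ℂ, O.IsHermitian →
      ∀ T : ℝ, 0 < T → ∀ r : ℕ, vLR * T ≤ r →
        ‖QuantumAnnealing.heisenberg v u G T (QuantumAnnealing.extendOp Subtype.val O) -
          QuantumAnnealing.extendOp Subtype.val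
            (QuantumAnnealing.heisenberg v u (QuantumAnnealing.ball X r).coe T
              (QuantumAnnealing.extendOp
                (Set.inclusion (QuantumAnnealing.verts_subset_ball X r)) O))‖
          ≤ C * ‖O‖ * Real.exp (-μ * r)) := by
  obtain ⟨expectedValue_close, heisenberg_close⟩ := mainTheorem4_general v u d m
  obtain ⟨vLR, C, hvLR, hC, heisenberg_close⟩ := heisenberg_close 1 zero_le_one
  exact ⟨fun ε hε T hT K => (expectedValue_close ε hε T hT K).imp
    fun r₀ h r hr V _ _ G _ hG X hX O _ => h r hr V G hG X hX O, vLR, 1, C, hvLR, one_pos, hC,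
    fun V _ _ G _ hG X hX O _ => heisenberg_close V G hG X hX O⟩
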